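/- Let $p>0$ and let $V:\mathbb R\to\mathbb R$ be measurable and $p$-periodic with $\|V\|_\infty\le R$ (essential supremum). Put $\mathbb T=\mathbb R/p\mathbb Z$, $D=-i\,\frac{d}{dx}$ and $\mathcal B=\left(-\frac{\pi}{p},\frac{\pi}{p}\right]$. For $k\in\mathbb R$ let $E_1(k)\le E_2(k)\le\cdots$ be the eigenvalues, repeated according to multiplicity, of the operator $H(k)=(D+k)^2+V$ on $L^2(\mathbb T)$ with domain $H^2(\mathbb T)$. There is a universal constant $C_2>0$, independent of $p$, $R$ and $V$, such that for all such $p$, $R$, $V$ the following hold. 1. For every $m\ge 1$, $E_m$ is differentiable at every $k\in\mathcal B\setminus\{0,\frac{\pi}{p}\}$, and $$\left|\frac{dE_m}{dk}(k)\right|\ \ge\ \frac{2|\sin(pk)|}{C_2\,p}\,e^{-2C_2R^{1/2}p}.$$ 2. For every $m\ge 1$ and all $k_1,k_2\in\mathcal B$, $$|E_m(k_2)-E_m(k_1)|\ \ge\ \frac{e^{-2C_2R^{1/2}p}}{\pi C_2}\,\bigl(|k_2|-|k_1|\bigr)^2 .$$ 3. For every $\epsilon\ge 0$, the set $$\mathcal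 B_\epsilon=\{k\in\mathcal B:\ \exists\, n,m\ge 1,\ n\ne m,\ |E_m(k)-E_n(k)|\le\epsilon\}$$ has Lebesgue measure $$\operatorname{Leb}(\mathcal B_\epsilon)\ \le\ 4\sqrt{C_2\pi}\;e^{C_2R^{1/2}p}\,\sqrt{\epsilon}.$$ -/

import Mathlib

open MeasureTheory Set
open scoped ContDiff

namespace FloquetBloch

/-- The Hilbert space `L²(𝕋, dq)` on the circle `𝕋 = ℝ / pℤ`, with Lebesgue measure of total
mass `p`. -/
abbrev L2 (p : ℝ) [Fact (0 < p)] : Type :=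
  Lp ℂ 2 (volume : Measure (AddCircle p))

/-- `v ∈ L²(𝕋)` is the weak derivative of `u ∈ L²(𝕋)`: integration by parts holds against every
smooth function on the circle, i.e. every smooth `p`-periodic `φ : ℝ → ℂ`. -/
def IsWeakDeriv (p : ℝ) [Fact (0 < p)] (u v : L2 p) : Prop :=
  ∀ φ : ℝ → ℂ, ContDiff ℝ ∞ φ → Function.Periodic φ p →
    ∫ x in (0 : ℝ)..p, u (x : AddCircle p) * deriv φ x =
      -∫ x in (0 : ℝ)..p, v (x : AddCircle p) * φ x

/-- The graph of `D + k` with `D = -i d/dx` and domain `H¹(𝕋)`: `u` has a weak derivative `v` in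
`L²(𝕋)`, and `g = (D + k) u = -i v + k u`. -/
def ShiftedMomentum (p : ℝ) [Fact (0 < p)] (k : ℝ) (u g : L2 p) : Prop :=
  ∃ v : L2 p, IsWeakDeriv p u v ∧ g = (-Complex.I) • v + (k : ℂ) • u

/-- The graph of the fiber operator `H(k) = (D + k)² + V` in `L²(𝕋)`. Its domain is `H²(𝕋)`:
as `u` has a weak derivative `u'` in `L²`, the vector `(D + k) u = -i u' + k u` has one in `L²` if
and only if `u'` has. -/
def FiberOperator (p : ℝ) [Fact (0 < p)] (V : AddCircle p → ℝ) (k : ℝ) (u f : L2 p) : Prop :=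
  ∃ g h : L2 p, ShiftedMomentum p k u g ∧ ShiftedMomentum p k g h ∧
    f =ᵐ[volume] fun t => h t + (V t : ℂ) * u t

/-- The eigenvalues of `H(k)`, listed in increasing order and repeated according to multiplicity.
The list is indexed from `0`: `bandEnergy p V n k` is the `(n + 1)`-st eigenvalue, the least `E`
such that there are `n + 1` linearly independent eigenvectors with eigenvalues at most `E`. -/
noncomputable def bandEnergy (p : ℝ) [Fact (0 < p)] (V : AddCircle p → ℝ) (n : ℕ) (k : ℝ) : ℝ :=
  sInf {E : ℝ | ∃ u : Fin (n + 1) → L2 p, LinearIndependent ℂ u ∧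
    ∀ i, ∃ μ : ℝ, μ ≤ E ∧ FiberOperator p V k (u i) ((μ : ℂ) • u i)}

/-- The Brillouin zone `(-π/p, π/p]`, a fundamental domain for `ℝ / (2π/p)ℤ`. -/
noncomputable def brillouinZone (p : ℝ) : Set ℝ :=
  Ioc (-(Real.pi / p)) (Real.pi / p)

/-- The quasimomenta at which two bands with distinct indices are within `ε` of each other. -/
noncomputable def closeBands (p : ℝ) [Fact (0 < p)] (V : AddCircle p → ℝ) (ε : ℝ) : Set ℝ :=
  {k ∈ brillouinZone p | ∃ n m : ℕ, n ≠ m ∧ |bandEnergy p V m k - bandEnergy p V n k| ≤ ε}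

end FloquetBloch

/-!
The proof rests on the discriminant `Δ(E)` of Hill's equation `-y'' + V y = E y`, the trace of its
monodromy matrix over one period (`FundamentalSystem.disc`). The gauge transformation
`y = e^{ikx} u` turns eigenfunctions of `H(k)` into solutions with multiplier `e^{ikp}`, so `E` is
an eigenvalue of `H(k)` if and only if `Δ(E) = 2 cos (kp)` (`FiberOperator.disc_eq`,
`exists_eigenvector`), and every band energy satisfies this equation (`disc_bandEnergy`). As `V` is
only measurable, solutions are understood in integrated form; they are obtained from a Volterra
equation, and all identities between them come from one Green's identity (`IsSolution.wronskian`).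

Three facts about `Δ` carry the estimates.

* `Δ` is Lipschitz on `[-R, ∞)`, which contains the spectrum, with constant
  `4 p² exp (9 √R p)` (`FundamentalSystem.abs_disc_sub_le`). Here solutions are compared with those
  of the free equation of frequency `√(max E R)`, so that the potential only contributes a factor
  `exp (3 √R p)` uniformly in `E`.
* `Δ' ≠ 0` where `|Δ| < 2`, because `-Δ'(E)` is the integral of a quadratic form in the fundamental
  solutions with discriminant `Δ² - 4` (`FundamentalSystem.deriv_disc_ne_zero`).
* `Δ` attains every value in `[-2, 2]` at arbitrarily large energies
  (`FundamentalSystem.exists_disc_eq`), since `Δ(E) - 2 cos (√E p)` tends to `0`.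

By the last two facts the set `{|Δ| < 2}` consists of intervals on each of which `Δ` is a bijection
onto `(-2, 2)`. When `e^{ikp}` is not real the eigenvalues are simple, and the `n`-th band energy is
the point of the level set `Δ = 2 cos (kp)` with exactly `n` points of that set below it
(`bandEnergy_eq_of_rank`). This rank is constant along an interval, so the band energy is an inverse
branch of `Δ` evaluated at `2 cos (kp)`, hence differentiable with
`Δ'(E) dE/dk = -2 p sin (kp)`; the Lipschitz bound gives the first claim.

The second claim follows from the Lipschitz bound applied to `2 cos (k₁ p) - 2 cos (k₂ p)` and the
elementary inequality `sq_sub_le_abs_cos_sub`. For the third, between two distinct energies on the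
same level set there is a critical point of `Δ`, where `|Δ| ≥ 2`. If the energies are within `ε` of
each other, `2 cos (kp)` is thus within a multiple of `ε` of `±2`, so `k` is close to `0` or `±π/p`.
-/

namespace FloquetBloch

/-! ### Solutions of `y'' = q y` for a bounded measurable potential -/

section ODE

variable {𝕜 : Type*} [RCLike 𝕜]

/-- Integration by parts of a `C¹` function against the primitive of an integrable one. -/
theorem mul_primitive_eq_integral {f f' h : ℝ → 𝕜} {x : ℝ} (hx : 0 ≤ x)
    (hf : ∀ t, HasDerivAt f (f' t) t) (hf' : Continuous f')
    (hh : IntervalIntegrable h volume 0 x) :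
    f x * ∫ s in 0..x, h s = (∫ t in 0..x, f' t * ∫ s in 0..t, h s) + ∫ t in 0..x, f t * h t := by
  have hfc : Continuous f := continuous_iff_continuousAt.2 fun t => (hf t).continuousAt
  have hh' : IntegrableOn h (Ioc 0 x) := (intervalIntegrable_iff_integrableOn_Ioc_of_le hx).1 hh
  have hf'i : IntegrableOn f' (Ioc 0 x) := hf'.integrableOn_Ioc
  set μ : Measure ℝ := volume.restrict (Ioc 0 x) with hμ
  have key : ∫ t, ∫ s, {z : ℝ × ℝ | z.2 ≤ z.1}.indicator (fun z => f' z.1 * h z.2) (t, s) ∂μ ∂μ =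
      ∫ s, ∫ t, {z : ℝ × ℝ | z.2 ≤ z.1}.indicator (fun z => f' z.1 * h z.2) (t, s) ∂μ ∂μ := by
    apply integral_integral_swap
    exact (Integrable.mul_prod hf'i hh').indicator
      (measurableSet_le measurable_snd measurable_fst)
  have h1 : ∫ t in 0..x, f' t * ∫ s in 0..t, h s =
      ∫ t, ∫ s, {z : ℝ × ℝ | z.2 ≤ z.1}.indicator (fun z => f' z.1 * h z.2) (t, s) ∂μ ∂μ := by
    rw [intervalIntegral.integral_of_le hx]
    refine setIntegral_congr_fun measurableSet_Ioc fun t ht => ?_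
    have : (fun s => {z : ℝ × ℝ | z.2 ≤ z.1}.indicator (fun z => f' z.1 * h z.2) (t, s)) =
        (Iic t).indicator (fun s => f' t * h s) := by
      ext s; simp [indicator]
    simp only [this]
    rw [integral_indicator measurableSet_Iic, hμ, Measure.restrict_restrict measurableSet_Iic,
      integral_const_mul, intervalIntegral.integral_of_le ht.1.le]
    congr 3
    ext s; simp only [mem_inter_iff, mem_Iic, mem_Ioc]
    constructor
    · rintro ⟨h1, h2⟩; exact ⟨h2, h1, h2.trans ht.2⟩
    · rintro ⟨h1, h2, h3⟩; exact ⟨h2, h1⟩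
  have h2 : ∫ s in 0..x, (f x - f s) * h s =
      ∫ s, ∫ t, {z : ℝ × ℝ | z.2 ≤ z.1}.indicator (fun z => f' z.1 * h z.2) (t, s) ∂μ ∂μ := by
    rw [intervalIntegral.integral_of_le hx]
    refine setIntegral_congr_fun measurableSet_Ioc fun s hs => ?_
    have : (fun t => {z : ℝ × ℝ | z.2 ≤ z.1}.indicator (fun z => f' z.1 * h z.2) (t, s)) =
        (Ici s).indicator (fun t => f' t * h s) := by
      ext s; simp [indicator]
    simp only [this]
    have hset : (Ici s ∩ Ioc 0 x : Set ℝ) = Icc s x := by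
      ext t; simp only [mem_inter_iff, mem_Ici, mem_Ioc, mem_Icc]
      constructor
      · rintro ⟨h1, h2⟩; exact ⟨h1, h2.2⟩
      · rintro ⟨h1, h2⟩; exact ⟨h1, hs.1.trans_le h1, h2⟩
    rw [integral_indicator measurableSet_Ici, hμ, Measure.restrict_restrict measurableSet_Ici,
      integral_mul_const, hset, integral_Icc_eq_integral_Ioc,
      ← intervalIntegral.integral_of_le hs.2,
      intervalIntegral.integral_eq_sub_of_hasDerivAt (fun t _ => hf t)
        (hf'.intervalIntegrable _ _)]
  have h3 : ∫ s in 0..x, (f x - f s) * h s =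
      f x * (∫ s in 0..x, h s) - ∫ s in 0..x, f s * h s := by
    rw [← intervalIntegral.integral_const_mul, ← intervalIntegral.integral_sub
      (hh.const_mul _) (hh.continuousOn_mul hfc.continuousOn)]
    simp only [sub_mul]
  rw [h1, key, ← h2, h3]; ring

/-- `y` is a solution of `y'' = q y` on `[0, p]` with derivative `y'`. As `q` is only measurable,
the equation is required in integrated form. For convenience `y` is continuously differentiable on
all of `ℝ`; its values outside `[0, p]` play no role. -/
structure IsSolution (p : ℝ) (q : ℝ → ℝ) (y y' : ℝ → 𝕜) : Prop where
  hasDerivAt : ∀ x, HasDerivAt y (y' x) x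
  continuous_deriv : Continuous y'
  deriv_eq : ∀ x ∈ Icc 0 p, y' x = y' 0 + ∫ t in 0..x, q t • y t

variable {p Q : ℝ} {q q₁ q₂ : ℝ → ℝ} {y y' z z' : ℝ → 𝕜}

theorem IsSolution.continuous (h : IsSolution p q y y') : Continuous y :=
  continuous_iff_continuousAt.2 fun t => (h.hasDerivAt t).continuousAt

theorem intervalIntegrable_smul (hq : IntervalIntegrable q volume 0 p) (hy : Continuous y)
    {x : ℝ} (hx : x ∈ Icc 0 p) : IntervalIntegrable (fun t => q t • y t) volume 0 x := by
  have h := hq.mono_set (c := 0) (d := x) (by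
    rw [uIcc_of_le hx.1, uIcc_of_le (hx.1.trans hx.2)]; exact Icc_subset_Icc_right hx.2)
  exact h.smul_continuousOn hy.continuousOn

/-- Green's identity: the Wronskian of solutions for two potentials. -/
theorem IsSolution.wronskian (hq₁ : IntervalIntegrable q₁ volume 0 p)
    (hq₂ : IntervalIntegrable q₂ volume 0 p) (hy : IsSolution p q₁ y y')
    (hz : IsSolution p q₂ z z') {x : ℝ} (hx : x ∈ Icc 0 p) :
    y x * z' x - y' x * z x =
      y 0 * z' 0 - y' 0 * z 0 + ∫ t in 0..x, (q₂ t - q₁ t) • (y t * z t) := by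
  have hsub : ∀ t ∈ uIcc 0 x, t ∈ Icc 0 p := fun t ht => by
    rw [uIcc_of_le hx.1] at ht; exact ⟨ht.1, ht.2.trans hx.2⟩
  have i1 := intervalIntegrable_smul hq₁ hy.continuous hx
  have i2 := intervalIntegrable_smul hq₂ hz.continuous hx
  have e1 := mul_primitive_eq_integral hx.1 hy.hasDerivAt hy.continuous_deriv i2
  have e2 := mul_primitive_eq_integral hx.1 hz.hasDerivAt hz.continuous_deriv i1
  have c1 : ∫ t in 0..x, y' t * ∫ s in 0..t, q₂ s • z s =
      (∫ t in 0..x, y' t * z' t) - (y x - y 0) * z' 0 := by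
    rw [← intervalIntegral.integral_eq_sub_of_hasDerivAt (fun t _ => hy.hasDerivAt t)
      (hy.continuous_deriv.intervalIntegrable _ _), ← intervalIntegral.integral_mul_const,
      ← intervalIntegral.integral_sub
        (f := fun t => y' t * z' t) (g := fun t => y' t * z' 0)
        ((hy.continuous_deriv.mul hz.continuous_deriv).intervalIntegrable _ _)
        ((hy.continuous_deriv.mul continuous_const).intervalIntegrable _ _)]
    refine intervalIntegral.integral_congr fun t ht => ?_
    simp only [hz.deriv_eq t (hsub t ht)]; ring
  have c2 : ∫ t in 0..x, z' t * ∫ s in 0..t, q₁ s • y s =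
      (∫ t in 0..x, y' t * z' t) - (z x - z 0) * y' 0 := by
    rw [← intervalIntegral.integral_eq_sub_of_hasDerivAt (fun t _ => hz.hasDerivAt t)
      (hz.continuous_deriv.intervalIntegrable _ _), ← intervalIntegral.integral_mul_const,
      ← intervalIntegral.integral_sub
        (f := fun t => y' t * z' t) (g := fun t => z' t * y' 0)
        ((hy.continuous_deriv.mul hz.continuous_deriv).intervalIntegrable _ _)
        ((hz.continuous_deriv.mul continuous_const).intervalIntegrable _ _)]
    refine intervalIntegral.integral_congr fun t ht => ?_
    simp only [hy.deriv_eq t (hsub t ht)]; ring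
  have c3 : ∫ t in 0..x, (q₂ t - q₁ t) • (y t * z t) =
      (∫ t in 0..x, y t * q₂ t • z t) - ∫ t in 0..x, z t * q₁ t • y t := by
    rw [← intervalIntegral.integral_sub (i2.continuousOn_mul hy.continuous.continuousOn)
      (i1.continuousOn_mul hz.continuous.continuousOn)]
    refine intervalIntegral.integral_congr fun t ht => ?_
    simp only [sub_smul, mul_smul_comm, mul_comm (z t) (y t)]
  rw [c1] at e1
  rw [c2] at e2
  rw [c3]
  have d1 := hy.deriv_eq x hx
  have d2 := hz.deriv_eq x hx
  linear_combination (y x) * d2 - (z x) * d1 + e1 - e2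

theorem IsSolution.linearCombination (hq : IntervalIntegrable q volume 0 p)
    (hy : IsSolution p q y y') (hz : IsSolution p q z z') (a b : 𝕜) :
    IsSolution p q (fun x => a * y x + b * z x) (fun x => a * y' x + b * z' x) where
  hasDerivAt x := ((hy.hasDerivAt x).const_mul a).add ((hz.hasDerivAt x).const_mul b)
  continuous_deriv := (hy.continuous_deriv.const_mul a).add (hz.continuous_deriv.const_mul b)
  deriv_eq x hx := by
    have : ∀ t, q t • (a * y t + b * z t) = a * q t • y t + b * q t • z t := fun t => by
      simp only [smul_add, mul_smul_comm]
    simp only [this]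
    rw [intervalIntegral.integral_add ((intervalIntegrable_smul hq hy.continuous hx).const_mul _)
      ((intervalIntegrable_smul hq hz.continuous hx).const_mul _),
      intervalIntegral.integral_const_mul, intervalIntegral.integral_const_mul,
      hy.deriv_eq x hx, hz.deriv_eq x hx]
    ring

theorem IsSolution.ofReal {y y' : ℝ → ℝ} (h : IsSolution p q y y') :
    IsSolution p q (fun x => (y x : ℂ)) (fun x => (y' x : ℂ)) where
  hasDerivAt x := (h.hasDerivAt x).ofReal_comp
  continuous_deriv := Complex.continuous_ofReal.comp h.continuous_deriv
  deriv_eq x hx := by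
    rw [h.deriv_eq x hx, Complex.ofReal_add, ← intervalIntegral.integral_ofReal]
    simp

theorem intervalIntegrable_of_bounded (hqm : AEStronglyMeasurable q volume)
    (hQ : ∀ᵐ x, |q x| ≤ Q) (a b : ℝ) : IntervalIntegrable q volume a b := by
  rw [intervalIntegrable_iff]
  exact Measure.integrableOn_of_bounded (M := Q) (by simp) hqm (ae_restrict_of_ae hQ)

/-- Existence of solutions with given initial data. In the norm `sup |e^{-λx} y(x)|` the Volterra
operator `y ↦ ∫∫ q y` has norm at most `Q / λ²`, so Banach's fixed point theorem applies. -/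
theorem exists_isSolution (hp : 0 ≤ p) (hqm : AEStronglyMeasurable q volume)
    (hQ : ∀ᵐ x, |q x| ≤ Q) (a b : ℝ) :
    ∃ y y' : ℝ → ℝ, IsSolution p q y y' ∧ y 0 = a ∧ y' 0 = b := by
  have hQ0 : 0 ≤ Q := by
    obtain ⟨x, hx⟩ := hQ.exists
    exact (abs_nonneg _).trans hx
  set l : ℝ := 1 + 2 * Q with hl
  have hl1 : 1 ≤ l := by linarith
  have hl0 : 0 < l := by linarith
  let w : C(Icc 0 p, ℝ) → ℝ → ℝ := fun z t => Real.exp (l * t) * z (projIcc 0 p hp t)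
  have hw : ∀ z, Continuous (w z) := fun z =>
    (by fun_prop : Continuous fun t : ℝ => Real.exp (l * t)).mul
      (z.continuous.comp continuous_projIcc)
  have hi : ∀ z u v, IntervalIntegrable (fun t => q t * w z t) volume u v := fun z u v =>
    (intervalIntegrable_of_bounded hqm hQ u v).mul_continuousOn (hw z).continuousOn
  let P : C(Icc 0 p, ℝ) → ℝ → ℝ := fun z x => ∫ t in 0..x, q t * w z t
  have hP : ∀ z, Continuous (P z) := fun z =>
    intervalIntegral.continuous_primitive (fun u v => hi z u v) 0
  let S : C(Icc 0 p, ℝ) → ℝ → ℝ := fun z x => a + b * x + ∫ t in 0..x, P z t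
  have hSd : ∀ z x, HasDerivAt (S z) (b + P z x) x := fun z x => by
    have h1 := intervalIntegral.integral_hasDerivAt_right ((hP z).intervalIntegrable 0 x)
      ((hP z).stronglyMeasurableAtFilter _ _) (hP z).continuousAt
    simpa using! (((hasDerivAt_id x).const_mul b).const_add a).add h1
  have hS : ∀ z, Continuous (S z) := fun z =>
    continuous_iff_continuousAt.2 fun t => (hSd z t).continuousAt
  let T : C(Icc 0 p, ℝ) → C(Icc 0 p, ℝ) := fun z =>
    ⟨fun x => Real.exp (-(l * x)) * S z x,
      (by fun_prop : Continuous fun t : Icc 0 p => Real.exp (-(l * t))).mul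
        ((hS z).comp continuous_subtype_val)⟩
  have hPd : ∀ z₁ z₂ x, 0 ≤ x → |P z₁ x - P z₂ x| ≤ Q * dist z₁ z₂ * Real.exp (l * x) / l := by
    intro z₁ z₂ x hx
    have hexp : ∫ t in 0..x, Real.exp (l * t) * (Q * dist z₁ z₂) =
        (Real.exp (l * x) - 1) / l * (Q * dist z₁ z₂) := by
      rw [intervalIntegral.integral_mul_const,
        intervalIntegral.integral_comp_mul_left (fun t => Real.exp t) hl0.ne', integral_exp]
      simp [field]
    have h1 : |P z₁ x - P z₂ x| ≤ ∫ t in 0..x, Real.exp (l * t) * (Q * dist z₁ z₂) := by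
      simp only [P]
      rw [← intervalIntegral.integral_sub (hi _ _ _) (hi _ _ _), ← Real.norm_eq_abs]
      refine intervalIntegral.norm_integral_le_of_norm_le hx ?_
        (Continuous.intervalIntegrable (by fun_prop) _ _)
      filter_upwards [hQ] with t ht _
      have h2 : |z₁ (projIcc 0 p hp t) - z₂ (projIcc 0 p hp t)| ≤ dist z₁ z₂ :=
        ContinuousMap.dist_apply_le_dist (f := z₁) (g := z₂) _
      have : q t * w z₁ t - q t * w z₂ t =
          Real.exp (l * t) * (q t * (z₁ (projIcc 0 p hp t) - z₂ (projIcc 0 p hp t))) := by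
        simp only [w]; ring
      rw [this, norm_mul, Real.norm_eq_abs, abs_of_pos (Real.exp_pos _), norm_mul]
      gcongr
      · exact ht
      · exact h2
    refine h1.trans ?_
    rw [hexp, div_mul_eq_mul_div]
    refine div_le_div_of_nonneg_right ?_ (by positivity)
    nlinarith [mul_nonneg hQ0 (dist_nonneg (x := z₁) (y := z₂))]
  have hSd' : ∀ z₁ z₂ x, 0 ≤ x →
      |S z₁ x - S z₂ x| ≤ Q * dist z₁ z₂ * Real.exp (l * x) / l ^ 2 := by
    intro z₁ z₂ x hx
    have hexp : ∫ t in 0..x, Q * dist z₁ z₂ * Real.exp (l * t) / l =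
        (Real.exp (l * x) - 1) / l ^ 2 * (Q * dist z₁ z₂) := by
      rw [intervalIntegral.integral_div, intervalIntegral.integral_const_mul,
        intervalIntegral.integral_comp_mul_left (fun t => Real.exp t) hl0.ne', integral_exp]
      simp [field]
    have h1 : |S z₁ x - S z₂ x| ≤ ∫ t in 0..x, Q * dist z₁ z₂ * Real.exp (l * t) / l := by
      simp only [S]
      rw [add_sub_add_left_eq_sub, ← intervalIntegral.integral_sub
        ((hP _).intervalIntegrable _ _) ((hP _).intervalIntegrable _ _), ← Real.norm_eq_abs]
      refine intervalIntegral.norm_integral_le_of_norm_le hx ?_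
        (Continuous.intervalIntegrable (by fun_prop) _ _)
      exact Filter.Eventually.of_forall fun t ht => hPd z₁ z₂ t ht.1.le
    refine h1.trans ?_
    rw [hexp, div_mul_eq_mul_div]
    refine div_le_div_of_nonneg_right ?_ (by positivity)
    nlinarith [mul_nonneg hQ0 (dist_nonneg (x := z₁) (y := z₂))]
  have hT : ContractingWith (1 / 2) T := by
    refine ⟨by norm_num [← NNReal.coe_lt_coe], LipschitzWith.of_dist_le_mul fun z₁ z₂ => ?_⟩
    rw [ContinuousMap.dist_le (by positivity)]
    intro x
    have h1 := hSd' z₁ z₂ x x.2.1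
    have h2 : dist (T z₁ x) (T z₂ x) = Real.exp (-(l * x)) * |S z₁ x - S z₂ x| := by
      rw [Real.dist_eq]
      change |Real.exp (-(l * x)) * S z₁ x - Real.exp (-(l * x)) * S z₂ x| = _
      rw [← mul_sub, abs_mul, abs_of_pos (Real.exp_pos _)]
    rw [h2]
    have h3 : Q / l ^ 2 ≤ 1 / 2 := by
      rw [div_le_div_iff₀ (by positivity) (by norm_num)]; nlinarith
    calc Real.exp (-(l * x)) * |S z₁ x - S z₂ x|
        ≤ Real.exp (-(l * x)) * (Q * dist z₁ z₂ * Real.exp (l * x) / l ^ 2) := by gcongr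
      _ = Q / l ^ 2 * dist z₁ z₂ * (Real.exp (-(l * x)) * Real.exp (l * x)) := by ring
      _ = Q / l ^ 2 * dist z₁ z₂ := by rw [← Real.exp_add]; simp
      _ ≤ 1 / 2 * dist z₁ z₂ := by gcongr
      _ = _ := by simp
  have : Nonempty (Icc 0 p) := ⟨⟨0, le_rfl, hp⟩⟩
  set z := ContractingWith.fixedPoint T hT
  have hz : T z = z := hT.fixedPoint_isFixedPt
  have hwS : ∀ t ∈ Icc 0 p, w z t = S z t := fun t ht => by
    have h1 : z ⟨t, ht⟩ = Real.exp (-(l * t)) * S z t := by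
      conv_lhs => rw [← hz]
      rfl
    simp only [w, projIcc_of_mem hp ht, h1]
    rw [← mul_assoc, ← Real.exp_add]; simp
  refine ⟨S z, fun x => b + P z x, ⟨hSd z, (hP z).const_add b, fun x hx => ?_⟩, by simp [S],
    by simp [P]⟩
  simp only [P, intervalIntegral.integral_same, add_zero, add_right_inj]
  refine intervalIntegral.integral_congr fun t ht => ?_
  rw [uIcc_of_le hx.1] at ht
  simp only [hwS t ⟨ht.1, ht.2.trans hx.2⟩, smul_eq_mul]

end ODE

/-! ### Variation of parameters and growth of solutions -/

section Growth

variable {p B w : ℝ} {q : ℝ → ℝ} {y y' : ℝ → ℝ}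

theorem isSolution_sin (p w x : ℝ) (hw : w ≠ 0) :
    IsSolution p (fun _ => -w ^ 2) (fun t => Real.sin (w * (x - t)) / w)
      (fun t => -Real.cos (w * (x - t))) := by
  have h1 : ∀ t, HasDerivAt (fun t => Real.sin (w * (x - t)) / w) (-Real.cos (w * (x - t))) t := by
    intro t
    have := ((((hasDerivAt_id t).const_sub x).const_mul w).sin).div_const w
    convert! this using 1
    simp [field]
  have h2 : ∀ t, HasDerivAt (fun t => -Real.cos (w * (x - t)))
      (-w ^ 2 * (Real.sin (w * (x - t)) / w)) t := by
    intro t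
    have := ((((hasDerivAt_id t).const_sub x).const_mul w).cos).neg
    convert! this using 1
    simp [field]
  refine ⟨h1, by fun_prop, fun t _ => ?_⟩
  have := intervalIntegral.integral_eq_sub_of_hasDerivAt (a := 0) (b := t) (fun t _ => h2 t)
    (Continuous.intervalIntegrable (by fun_prop) _ _)
  simp only [smul_eq_mul, this]; ring

theorem isSolution_cos (p w x : ℝ) :
    IsSolution p (fun _ => -w ^ 2) (fun t => Real.cos (w * (x - t)))
      (fun t => w * Real.sin (w * (x - t))) := by
  have h1 : ∀ t, HasDerivAt (fun t => Real.cos (w * (x - t))) (w * Real.sin (w * (x - t))) t := by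
    intro t
    have := ((((hasDerivAt_id t).const_sub x).const_mul w).cos)
    convert! this using 1
    simp; ring
  have h2 : ∀ t, HasDerivAt (fun t => w * Real.sin (w * (x - t)))
      (-w ^ 2 * Real.cos (w * (x - t))) t := by
    intro t
    have := ((((hasDerivAt_id t).const_sub x).const_mul w).sin).const_mul w
    convert! this using 1
    simp; ring
  refine ⟨h1, by fun_prop, fun t _ => ?_⟩
  have := intervalIntegral.integral_eq_sub_of_hasDerivAt (a := 0) (b := t) (fun t _ => h2 t)
    (Continuous.intervalIntegrable (by fun_prop) _ _)
  simp only [smul_eq_mul, this]; ring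

/-- Variation of parameters: Green's identity against the sine kernel of `z'' = -w² z`. -/
theorem IsSolution.eq_variation (hq : IntervalIntegrable q volume 0 p) (hy : IsSolution p q y y')
    (hw : w ≠ 0) {x : ℝ} (hx : x ∈ Icc 0 p) :
    y x = y 0 * Real.cos (w * x) + y' 0 * (Real.sin (w * x) / w) +
      ∫ t in 0..x, (q t + w ^ 2) * (y t * (Real.sin (w * (x - t)) / w)) := by
  have h := hy.wronskian hq intervalIntegrable_const (isSolution_sin p w x hw) hx
  have e : ∫ t in 0..x, (-w ^ 2 - q t) • (y t * (Real.sin (w * (x - t)) / w)) =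
      -∫ t in 0..x, (q t + w ^ 2) * (y t * (Real.sin (w * (x - t)) / w)) := by
    rw [← intervalIntegral.integral_neg]
    refine intervalIntegral.integral_congr fun t _ => ?_
    simp only [smul_eq_mul]; ring
  rw [e] at h
  simp only [sub_self, mul_zero, Real.cos_zero, Real.sin_zero, sub_zero, zero_div] at h
  linear_combination -h

theorem IsSolution.deriv_eq_variation (hq : IntervalIntegrable q volume 0 p)
    (hy : IsSolution p q y y') {x : ℝ} (hx : x ∈ Icc 0 p) :
    y' x = -(y 0 * (w * Real.sin (w * x))) + y' 0 * Real.cos (w * x) +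
      ∫ t in 0..x, (q t + w ^ 2) * (y t * Real.cos (w * (x - t))) := by
  have h := hy.wronskian hq intervalIntegrable_const (isSolution_cos p w x) hx
  have e : ∫ t in 0..x, (-w ^ 2 - q t) • (y t * Real.cos (w * (x - t))) =
      -∫ t in 0..x, (q t + w ^ 2) * (y t * Real.cos (w * (x - t))) := by
    rw [← intervalIntegral.integral_neg]
    refine intervalIntegral.integral_congr fun t _ => ?_
    simp only [smul_eq_mul]; ring
  rw [e] at h
  simp only [sub_self, mul_zero, Real.cos_zero, Real.sin_zero, sub_zero, mul_one] at h
  linear_combination -h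

/-- Grönwall's inequality in integral form, for the primitive of `|y|`. -/
theorem integral_abs_le_of_le {a K : ℝ} (hK : 0 < K) (hy : Continuous y)
    (h : ∀ x ∈ Icc 0 p, |y x| ≤ a + K * ∫ t in 0..x, |y t|) {x : ℝ} (hx : x ∈ Icc 0 p) :
    ∫ t in 0..x, |y t| ≤ a / K * (Real.exp (K * x) - 1) := by
  have hd : ∀ x, HasDerivAt (fun x => ∫ t in 0..x, |y t|) |y x| x := fun x =>
    intervalIntegral.integral_hasDerivAt_right (hy.abs.intervalIntegrable 0 x)
      (hy.abs.stronglyMeasurableAtFilter _ _) hy.abs.continuousAt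
  have := norm_le_gronwallBound_of_norm_deriv_right_le (f := fun x => ∫ t in 0..x, |y t|)
    (f' := fun x => |y x|) (δ := 0) (K := K) (ε := a) (a := 0) (b := p)
    (fun x _ => (hd x).continuousAt.continuousWithinAt) (fun x _ => (hd x).hasDerivWithinAt)
    (by simp) (fun x hx' => by
      have h0 : 0 ≤ ∫ t in 0..x, |y t| :=
        intervalIntegral.integral_nonneg hx'.1 fun _ _ => abs_nonneg _
      have := h x ⟨hx'.1, hx'.2.le⟩
      rw [Real.norm_eq_abs, Real.norm_eq_abs, abs_abs, abs_of_nonneg h0]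
      linarith) x hx
  rw [gronwallBound_of_K_ne_0 hK.ne'] at this
  have h2 := (le_abs_self _).trans this
  simpa using! h2

theorem abs_integral_kernel_le {κ : ℝ → ℝ} {C x : ℝ} (hx : 0 ≤ x)
    (hB : ∀ᵐ t, |q t + w ^ 2| ≤ B) (hy : Continuous y)
    (hκ : ∀ t, |κ t| ≤ C) :
    |∫ t in 0..x, (q t + w ^ 2) * (y t * κ t)| ≤ B * C * ∫ t in 0..x, |y t| := by
  rw [← intervalIntegral.integral_const_mul, ← Real.norm_eq_abs]
  refine intervalIntegral.norm_integral_le_of_norm_le hx ?_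
    ((hy.abs.const_mul _).intervalIntegrable _ _)
  filter_upwards [hB] with t ht _
  rw [norm_mul, norm_mul, Real.norm_eq_abs, Real.norm_eq_abs, Real.norm_eq_abs]
  have hB0 : 0 ≤ B := (abs_nonneg _).trans ht
  calc |q t + w ^ 2| * (|y t| * |κ t|) ≤ B * (|y t| * C) := by gcongr; exact hκ t
    _ = _ := by ring

/-- Growth of solutions relative to the frequency `w`. -/
theorem IsSolution.growth (hq : IntervalIntegrable q volume 0 p) (hy : IsSolution p q y y')
    (hw : 0 < w) (hB0 : 0 < B) (hB : ∀ᵐ t, |q t + w ^ 2| ≤ B) {x : ℝ} (hx : x ∈ Icc 0 p) :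
    |y x| ≤ (|y 0| + |y' 0| / w) * Real.exp (B / w * x) ∧
      |y' x| ≤ w * ((|y 0| + |y' 0| / w) * Real.exp (B / w * x)) ∧
      ∫ t in 0..x, |y t| ≤ (|y 0| + |y' 0| / w) / (B / w) * (Real.exp (B / w * x) - 1) := by
  set a := |y 0| + |y' 0| / w with ha
  have hK : 0 < B / w := by positivity
  have h1 : ∀ x ∈ Icc 0 p, |y x| ≤ a + B / w * ∫ t in 0..x, |y t| := by
    intro x hx
    have hk := abs_integral_kernel_le (q := q) (w := w) (B := B)
      (κ := fun t => Real.sin (w * (x - t)) / w) (C := 1 / w) hx.1 hB hy.continuous (fun t => by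
        rw [abs_div, abs_of_pos hw]; gcongr; exact Real.abs_sin_le_one _)
    rw [hy.eq_variation hq hw.ne' hx]
    have a1 : |y 0 * Real.cos (w * x)| ≤ |y 0| := by
      rw [abs_mul]; exact mul_le_of_le_one_right (abs_nonneg _) (Real.abs_cos_le_one _)
    have a2 : |y' 0 * (Real.sin (w * x) / w)| ≤ |y' 0| / w := by
      rw [abs_mul, abs_div, abs_of_pos hw, mul_div_assoc']
      gcongr
      exact mul_le_of_le_one_right (abs_nonneg _) (Real.abs_sin_le_one _)
    calc _ ≤ |y 0 * Real.cos (w * x)| + |y' 0 * (Real.sin (w * x) / w)| +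
          |∫ t in 0..x, (q t + w ^ 2) * (y t * (Real.sin (w * (x - t)) / w))| := abs_add_three _ _ _
      _ ≤ |y 0| + |y' 0| / w + B * (1 / w) * ∫ t in 0..x, |y t| := by gcongr
      _ = _ := by rw [ha]; ring
  have h2 := integral_abs_le_of_le hK hy.continuous h1 hx
  have h3 : B * ∫ t in 0..x, |y t| ≤ w * a * (Real.exp (B / w * x) - 1) := by
    calc _ ≤ B * (a / (B / w) * (Real.exp (B / w * x) - 1)) := by gcongr
      _ = _ := by field_simp
  refine ⟨?_, ?_, h2⟩
  · have h4 := h1 x hx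
    have h5 : B / w * ∫ t in 0..x, |y t| ≤ a * (Real.exp (B / w * x) - 1) := by
      calc _ ≤ B / w * (a / (B / w) * (Real.exp (B / w * x) - 1)) := by gcongr
        _ = _ := by field_simp
    linarith
  · have hk := abs_integral_kernel_le (q := q) (w := w) (B := B)
      (κ := fun t => Real.cos (w * (x - t))) (C := 1) hx.1 hB hy.continuous
      (fun t => Real.abs_cos_le_one _)
    rw [hy.deriv_eq_variation (w := w) hq hx]
    have a1 : |-(y 0 * (w * Real.sin (w * x)))| ≤ w * |y 0| := by
      rw [abs_neg, abs_mul, abs_mul, abs_of_pos hw]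
      have := mul_le_of_le_one_right (a := w * |y 0|) (by positivity) (Real.abs_sin_le_one (w * x))
      linarith
    have a2 : |y' 0 * Real.cos (w * x)| ≤ |y' 0| := by
      rw [abs_mul]; exact mul_le_of_le_one_right (abs_nonneg _) (Real.abs_cos_le_one _)
    have a3 : w * a = w * |y 0| + |y' 0| := by rw [ha]; field_simp
    calc _ ≤ |-(y 0 * (w * Real.sin (w * x)))| + |y' 0 * Real.cos (w * x)| +
          |∫ t in 0..x, (q t + w ^ 2) * (y t * Real.cos (w * (x - t)))| := abs_add_three _ _ _
      _ ≤ w * |y 0| + |y' 0| + B * 1 * ∫ t in 0..x, |y t| := by gcongr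
      _ ≤ _ := by linarith

end Growth

/-! ### The fundamental system and the discriminant -/

/-- For every energy `E`, the solutions `c`, `s` of `-y'' + V y = E y` on `[0, p]` with initial
data `(c, c') = (1, 0)` and `(s, s') = (0, 1)` at `0`. The first argument is `E`. -/
structure FundamentalSystem (p : ℝ) (V : ℝ → ℝ) where
  /-- the cosine-like solution -/
  c : ℝ → ℝ → ℝ
  /-- the derivative of the cosine-like solution -/
  c' : ℝ → ℝ → ℝ
  /-- the sine-like solution -/
  s : ℝ → ℝ → ℝ
  /-- the derivative of the sine-like solution -/
  s' : ℝ → ℝ → ℝ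
  sol_c : ∀ E, IsSolution p (fun x => V x - E) (c E) (c' E)
  sol_s : ∀ E, IsSolution p (fun x => V x - E) (s E) (s' E)
  c_zero : ∀ E, c E 0 = 1
  c'_zero : ∀ E, c' E 0 = 0
  s_zero : ∀ E, s E 0 = 0
  s'_zero : ∀ E, s' E 0 = 1

/-- `V` is a measurable function bounded by `R` almost everywhere. -/
structure BoundedPotential (V : ℝ → ℝ) (R : ℝ) : Prop where
  meas : AEStronglyMeasurable V volume
  bound : ∀ᵐ x, |V x| ≤ R

theorem BoundedPotential.mono {V : ℝ → ℝ} {R R' : ℝ} (h : BoundedPotential V R) (hR : R ≤ R') :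
    BoundedPotential V R' :=
  ⟨h.meas, h.bound.mono fun _ hx => hx.trans hR⟩

theorem BoundedPotential.nonneg {V : ℝ → ℝ} {R : ℝ} (h : BoundedPotential V R) : 0 ≤ R := by
  obtain ⟨x, hx⟩ := h.bound.exists
  exact (abs_nonneg _).trans hx

theorem BoundedPotential.sub_const {V : ℝ → ℝ} {R : ℝ} (h : BoundedPotential V R) (E : ℝ) :
    BoundedPotential (fun x => V x - E) (R + |E|) :=
  ⟨h.meas.sub aestronglyMeasurable_const,
    h.bound.mono fun _ hx => (abs_sub _ _).trans (by gcongr)⟩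

theorem BoundedPotential.intervalIntegrable {V : ℝ → ℝ} {R : ℝ} (h : BoundedPotential V R)
    (E a b : ℝ) : IntervalIntegrable (fun x => V x - E) volume a b :=
  intervalIntegrable_of_bounded (h.sub_const E).meas (h.sub_const E).bound a b

theorem BoundedPotential.nonempty_fundamentalSystem {p R : ℝ} {V : ℝ → ℝ}
    (h : BoundedPotential V R) (hp : 0 ≤ p) : Nonempty (FundamentalSystem p V) := by
  choose c c' h1 h2 h3 using fun E =>
    exists_isSolution hp (h.sub_const E).meas (h.sub_const E).bound 1 0
  choose s s' g1 g2 g3 using fun E =>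
    exists_isSolution hp (h.sub_const E).meas (h.sub_const E).bound 0 1
  exact ⟨⟨c, c', s, s', h1, g1, h2, h3, g2, g3⟩⟩

namespace FundamentalSystem

variable {p R : ℝ} {V : ℝ → ℝ} (F : FundamentalSystem p V)

/-- The discriminant: the trace of the monodromy matrix. -/
noncomputable def disc (E : ℝ) : ℝ := F.c E p + F.s' E p

theorem det_eq_one (hV : BoundedPotential V R) (E : ℝ) {x : ℝ} (hx : x ∈ Icc 0 p) :
    F.c E x * F.s' E x - F.c' E x * F.s E x = 1 := by
  have := (F.sol_c E).wronskian (hV.intervalIntegrable E 0 p) (hV.intervalIntegrable E 0 p)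
    (F.sol_s E) hx
  simpa [F.c_zero, F.c'_zero, F.s_zero, F.s'_zero] using this

/-- A solution is determined by its initial data. -/
theorem eq_of_isSolution (hV : BoundedPotential V R) {E : ℝ} {y y' : ℝ → ℂ}
    (hy : IsSolution p (fun x => V x - E) y y') {x : ℝ} (hx : x ∈ Icc 0 p) :
    y x = y 0 * F.c E x + y' 0 * F.s E x ∧ y' x = y 0 * F.c' E x + y' 0 * F.s' E x := by
  have hq := hV.intervalIntegrable E 0 p
  have w1 := hy.wronskian hq hq (F.sol_c E).ofReal hx
  have w2 := hy.wronskian hq hq (F.sol_s E).ofReal hx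
  have d : (F.c E x * F.s' E x - F.c' E x * F.s E x : ℂ) = 1 := by
    exact_mod_cast F.det_eq_one hV E hx
  simp only [F.c_zero, F.c'_zero, F.s_zero, F.s'_zero, sub_self, zero_smul,
    intervalIntegral.integral_zero, Complex.ofReal_zero, Complex.ofReal_one] at w1 w2
  constructor
  · linear_combination (-y x) * d + w2 * F.c E x - w1 * F.s E x
  · linear_combination (-y' x) * d + w2 * F.c' E x - w1 * F.s' E x

/-- The growth bounds with the frequency `w = √(max E R)`, uniformly in the energies `E ≥ -R`. -/
theorem growth (hV : BoundedPotential V R) (hR : 0 < R) {E : ℝ} (hE : -R ≤ E) {x : ℝ}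
    (hx : x ∈ Icc 0 p) :
    |F.c E x| ≤ Real.exp (3 * √R * p) ∧ |F.c' E x| ≤ √(max E R) * Real.exp (3 * √R * p) ∧
      |F.s E x| ≤ Real.exp (3 * √R * p) / √(max E R) ∧ |F.s' E x| ≤ Real.exp (3 * √R * p) := by
  have hm : 0 < max E R := lt_max_of_lt_right hR
  set w := √(max E R) with hw
  have hw0 : 0 < w := Real.sqrt_pos.2 hm
  have hwR : √R ≤ w := Real.sqrt_le_sqrt (le_max_right _ _)
  have hsq : w ^ 2 = max E R := Real.sq_sqrt hm.le
  have hB : ∀ᵐ t, |V t - E + w ^ 2| ≤ 3 * R := by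
    filter_upwards [hV.bound] with t ht
    rw [hsq, abs_le]
    rw [abs_le] at ht
    rcases le_total E R with h | h
    · rw [max_eq_right h]; constructor <;> linarith
    · rw [max_eq_left h]; constructor <;> linarith
  have hq := hV.intervalIntegrable E 0 p
  have hexp : Real.exp (3 * R / w * x) ≤ Real.exp (3 * √R * p) := by
    have h1 : R / w ≤ √R := by
      rw [div_le_iff₀ hw0]
      calc R = √R * √R := (Real.mul_self_sqrt hR.le).symm
        _ ≤ _ := by gcongr
    have hx0 := hx.1
    have hx1 := hx.2
    rw [mul_div_assoc]
    gcongr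
  have g1 := (F.sol_c E).growth hq hw0 (by positivity) hB hx
  have g2 := (F.sol_s E).growth hq hw0 (by positivity) hB hx
  simp only [F.c_zero, F.c'_zero, F.s_zero, F.s'_zero, abs_zero, abs_one, zero_div, add_zero,
    zero_add, one_mul] at g1 g2
  refine ⟨g1.1.trans hexp, g1.2.1.trans (by gcongr), ?_, ?_⟩
  · refine g2.1.trans ?_
    rw [one_div_mul_eq_div]; gcongr
  · refine g2.2.1.trans ?_
    rw [one_div_mul_eq_div, mul_div_cancel₀ _ hw0.ne']; exact hexp

/-- A bound on the fundamental system that is uniform for bounded energies. -/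
theorem growth_of_abs_le (hV : BoundedPotential V R) {E N : ℝ} (hE : |E| ≤ N) {x : ℝ}
    (hx : x ∈ Icc 0 p) :
    |F.c E x| ≤ Real.exp ((R + N + 1) * p) ∧ |F.c' E x| ≤ Real.exp ((R + N + 1) * p) ∧
      |F.s E x| ≤ Real.exp ((R + N + 1) * p) ∧ |F.s' E x| ≤ Real.exp ((R + N + 1) * p) := by
  have hR := hV.nonneg
  have hN : 0 ≤ N := (abs_nonneg _).trans hE
  have hB : ∀ᵐ t, |V t - E + 1 ^ 2| ≤ R + N + 1 := by
    filter_upwards [hV.bound] with t ht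
    rw [abs_le] at *
    constructor <;> linarith
  have hq := hV.intervalIntegrable E 0 p
  have hexp : Real.exp ((R + N + 1) / 1 * x) ≤ Real.exp ((R + N + 1) * p) := by
    rw [div_one]
    gcongr
    exact hx.2
  have g1 := (F.sol_c E).growth hq one_pos (by positivity) hB hx
  have g2 := (F.sol_s E).growth hq one_pos (by positivity) hB hx
  simp only [F.c_zero, F.c'_zero, F.s_zero, F.s'_zero, abs_zero, abs_one, add_zero,
    zero_add, one_mul, div_one] at g1 g2 hexp
  exact ⟨g1.1.trans hexp, g1.2.1.trans hexp, g2.1.trans hexp, g2.2.1.trans hexp⟩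

/-- The dependence of the fundamental system on the energy, as an exact difference formula. -/
theorem sub_eq (hV : BoundedPotential V R) (E E' : ℝ) {x : ℝ} (hx : x ∈ Icc 0 p) :
    F.c E' x = F.c E x + (E - E') * (F.s E x * (∫ t in 0..x, F.c E t * F.c E' t) -
        F.c E x * ∫ t in 0..x, F.s E t * F.c E' t) ∧
      F.s E' x = F.s E x + (E - E') * (F.s E x * (∫ t in 0..x, F.c E t * F.s E' t) -
        F.c E x * ∫ t in 0..x, F.s E t * F.s E' t) ∧
      F.s' E' x = F.s' E x + (E - E') * (F.s' E x * (∫ t in 0..x, F.c E t * F.s E' t) -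
        F.c' E x * ∫ t in 0..x, F.s E t * F.s E' t) := by
  have hq := hV.intervalIntegrable E 0 p
  have hq' := hV.intervalIntegrable E' 0 p
  have cc := (F.sol_c E).wronskian hq hq' (F.sol_c E') hx
  have cs := (F.sol_c E).wronskian hq hq' (F.sol_s E') hx
  have sc := (F.sol_s E).wronskian hq hq' (F.sol_c E') hx
  have ss := (F.sol_s E).wronskian hq hq' (F.sol_s E') hx
  have d := F.det_eq_one hV E hx
  simp only [F.c_zero, F.c'_zero, F.s_zero, F.s'_zero, sub_sub_sub_cancel_left, smul_eq_mul,
    intervalIntegral.integral_const_mul] at cc cs sc ss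
  refine ⟨?_, ?_, ?_⟩
  · linear_combination (-F.c E' x) * d + F.s E x * cc - F.c E x * sc
  · linear_combination (-F.s E' x) * d + F.s E x * cs - F.c E x * ss
  · linear_combination (-F.s' E' x) * d + F.s' E x * cs - F.c' E x * ss

theorem continuous_c (E : ℝ) : Continuous (F.c E) := (F.sol_c E).continuous
theorem continuous_s (E : ℝ) : Continuous (F.s E) := (F.sol_s E).continuous

theorem disc_sub (hp : 0 ≤ p) (hV : BoundedPotential V R) (E E' : ℝ) :
    F.disc E' - F.disc E = (E - E') * (F.s E p * (∫ t in 0..p, F.c E t * F.c E' t) -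
        F.c E p * (∫ t in 0..p, F.s E t * F.c E' t) +
        F.s' E p * (∫ t in 0..p, F.c E t * F.s E' t) -
        F.c' E p * ∫ t in 0..p, F.s E t * F.s E' t) := by
  have h := F.sub_eq hV E E' (right_mem_Icc.2 hp)
  simp only [disc]
  linear_combination h.1 + h.2.2

theorem abs_integral_mul_le {f g : ℝ → ℝ} {a b x : ℝ} (hx : 0 ≤ x)
    (hf : ∀ t ∈ Icc 0 x, |f t| ≤ a) (hg : ∀ t ∈ Icc 0 x, |g t| ≤ b) :
    |∫ t in 0..x, f t * g t| ≤ a * b * x := by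
  have := intervalIntegral.norm_integral_le_of_norm_le_const (a := 0) (b := x)
    (f := fun t => f t * g t) (C := a * b) (fun t ht => by
      rw [uIoc_of_le hx] at ht
      have ht' : t ∈ Icc 0 x := ⟨ht.1.le, ht.2⟩
      rw [norm_mul]
      have h1 := hf t ht'
      exact mul_le_mul h1 (hg t ht') (norm_nonneg _) ((abs_nonneg _).trans h1))
  simpa [abs_of_nonneg hx] using this

/-- The sine-like solution is at most of the order of the period: it is the primitive of `s'`. -/
theorem abs_s_le (hV : BoundedPotential V R) (hR : 0 < R) {E : ℝ} (hE : -R ≤ E) {x : ℝ}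
    (hx : x ∈ Icc 0 p) : |F.s E x| ≤ p * Real.exp (3 * √R * p) := by
  have h1 : F.s E x = ∫ t in 0..x, F.s' E t := by
    rw [intervalIntegral.integral_eq_sub_of_hasDerivAt (fun t _ => (F.sol_s E).hasDerivAt t)
      ((F.sol_s E).continuous_deriv.intervalIntegrable _ _), F.s_zero, sub_zero]
  rw [h1, ← Real.norm_eq_abs]
  have := intervalIntegral.norm_integral_le_of_norm_le_const (a := 0) (b := x)
    (f := F.s' E) (C := Real.exp (3 * √R * p)) (fun t ht => by
      rw [uIoc_of_le hx.1] at ht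
      exact (F.growth hV hR hE ⟨ht.1.le, ht.2.trans hx.2⟩).2.2.2)
  refine this.trans ?_
  rw [sub_zero, abs_of_nonneg hx.1, mul_comm]
  gcongr
  exact hx.2

theorem abs_disc_sub_le_of_pos (hp : 0 ≤ p) (hV : BoundedPotential V R) (hR : 0 < R) {E E' : ℝ}
    (hE : -R ≤ E) (hE' : -R ≤ E') :
    |F.disc E' - F.disc E| ≤ 4 * p ^ 2 * Real.exp (9 * √R * p) * |E' - E| := by
  set A := Real.exp (3 * √R * p) with hA
  have hA3 : Real.exp (9 * √R * p) = A ^ 3 := by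
    rw [hA, ← Real.exp_nat_mul]; congr 1; push_cast; ring
  have hA0 : 0 < A := Real.exp_pos _
  have hpp : p ∈ Icc 0 p := right_mem_Icc.2 hp
  have hw0 : 0 < √(max E R) := Real.sqrt_pos.2 (lt_max_of_lt_right hR)
  have g := fun x (hx : x ∈ Icc 0 p) => F.growth hV hR hE hx
  have g' := fun x (hx : x ∈ Icc 0 p) => F.growth hV hR hE' hx
  have hs := fun x (hx : x ∈ Icc 0 p) => F.abs_s_le hV hR hE hx
  have hs' := fun x (hx : x ∈ Icc 0 p) => F.abs_s_le hV hR hE' hx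
  obtain ⟨g1, g2, g3, g4⟩ := g p hpp
  have gp := hs p hpp
  have t1 : |F.s E p * ∫ t in 0..p, F.c E t * F.c E' t| ≤ p ^ 2 * A ^ 3 := by
    rw [abs_mul]
    calc _ ≤ (p * A) * (A * A * p) := by
          gcongr
          exact abs_integral_mul_le hp (fun t ht => (g t ht).1) (fun t ht => (g' t ht).1)
      _ = _ := by ring
  have t2 : |F.c E p * ∫ t in 0..p, F.s E t * F.c E' t| ≤ p ^ 2 * A ^ 3 := by
    rw [abs_mul]
    calc _ ≤ A * ((p * A) * A * p) := by
          gcongr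
          exact abs_integral_mul_le hp hs (fun t ht => (g' t ht).1)
      _ = _ := by ring
  have t3 : |F.s' E p * ∫ t in 0..p, F.c E t * F.s E' t| ≤ p ^ 2 * A ^ 3 := by
    rw [abs_mul]
    calc _ ≤ A * (A * (p * A) * p) := by
          gcongr
          exact abs_integral_mul_le hp (fun t ht => (g t ht).1) hs'
      _ = _ := by ring
  have t4 : |F.c' E p * ∫ t in 0..p, F.s E t * F.s E' t| ≤ p ^ 2 * A ^ 3 := by
    rw [abs_mul]
    calc _ ≤ (√(max E R) * A) * (A / √(max E R) * (p * A) * p) := by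
          gcongr
          exact abs_integral_mul_le hp (fun t ht => (g t ht).2.2.1) hs'
      _ = _ := by field_simp
  rw [F.disc_sub hp hV, abs_mul, abs_sub_comm E E', hA3, mul_comm]
  gcongr
  rw [abs_le] at *
  constructor <;> linarith

/-- The discriminant is Lipschitz on `[-R, ∞)`. The bound for `R = 0` is the limit of the
bounds for `R' > 0`. -/
theorem abs_disc_sub_le (hp : 0 ≤ p) (hV : BoundedPotential V R) {E E' : ℝ}
    (hE : -R ≤ E) (hE' : -R ≤ E') :
    |F.disc E' - F.disc E| ≤ 4 * p ^ 2 * Real.exp (9 * √R * p) * |E' - E| := by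
  have ht : Filter.Tendsto (fun r => 4 * p ^ 2 * Real.exp (9 * √r * p) * |E' - E|)
      (nhdsWithin R (Ioi R)) (nhds (4 * p ^ 2 * Real.exp (9 * √R * p) * |E' - E|)) :=
    (Continuous.tendsto (by fun_prop) R).mono_left nhdsWithin_le_nhds
  refine ge_of_tendsto ht ?_
  filter_upwards [self_mem_nhdsWithin] with r hr
  have hr : R < r := hr
  exact F.abs_disc_sub_le_of_pos hp (hV.mono hr.le) (hV.nonneg.trans_lt hr) (by linarith)
    (by linarith)

end FundamentalSystem

namespace FundamentalSystem

open Filter Topology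

variable {p R : ℝ} {V : ℝ → ℝ} (F : FundamentalSystem p V)

/-! ### The derivative of the discriminant -/

theorem tendsto_of_energy (hV : BoundedPotential V R) (E : ℝ) {x : ℝ} (hx : x ∈ Icc 0 p) :
    Tendsto (fun E' => F.c E' x) (𝓝 E) (𝓝 (F.c E x)) ∧
      Tendsto (fun E' => F.s E' x) (𝓝 E) (𝓝 (F.s E x)) := by
  set K := Real.exp ((R + (|E| + 1) + 1) * p) with hK
  have hK0 : 0 < K := Real.exp_pos _
  have hnear : ∀ᶠ E' in 𝓝 E, |E'| ≤ |E| + 1 :=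
    continuous_abs.continuousAt.eventually_le_const (lt_add_one _)
  have hE := fun t (ht : t ∈ Icc 0 p) => F.growth_of_abs_le hV (E := E) (N := |E| + 1)
    (by linarith) ht
  have hsub : ∀ t ∈ Icc 0 x, t ∈ Icc 0 p := fun t ht => ⟨ht.1, ht.2.trans hx.2⟩
  have hlim : Tendsto (fun E' => |E - E'| * (2 * (K * (K * K * x)))) (𝓝 E) (𝓝 0) := by
    have : Continuous fun E' => |E - E'| * (2 * (K * (K * K * x))) := by fun_prop
    simpa using this.tendsto E
  have key : ∀ f g : ℝ → ℝ → ℝ, (∀ E', |E'| ≤ |E| + 1 → ∀ t ∈ Icc 0 p, |g E' t| ≤ K) →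
      (∀ E', f E' x = f E x + (E - E') * (F.s E x * (∫ t in 0..x, F.c E t * g E' t) -
        F.c E x * ∫ t in 0..x, F.s E t * g E' t)) →
      Tendsto (fun E' => f E' x) (𝓝 E) (𝓝 (f E x)) := by
    intro f g hg hfg
    rw [tendsto_iff_norm_sub_tendsto_zero]
    refine squeeze_zero' (Eventually.of_forall fun _ => norm_nonneg _) ?_ hlim
    filter_upwards [hnear] with E' hE'
    rw [hfg E', add_sub_cancel_left, Real.norm_eq_abs, abs_mul]
    gcongr
    have b1 := abs_integral_mul_le (a := K) (b := K) hx.1 (fun t ht => (hE t (hsub t ht)).1)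
      (fun t ht => hg E' hE' t (hsub t ht))
    have b2 := abs_integral_mul_le (a := K) (b := K) hx.1 (fun t ht => (hE t (hsub t ht)).2.2.1)
      (fun t ht => hg E' hE' t (hsub t ht))
    calc _ ≤ |F.s E x * ∫ t in 0..x, F.c E t * g E' t| +
          |F.c E x * ∫ t in 0..x, F.s E t * g E' t| := abs_sub _ _
      _ ≤ K * (K * K * x) + K * (K * K * x) := by
          rw [abs_mul, abs_mul]
          have h1 : |F.s E x| ≤ K := (hE x hx).2.2.1
          have h2 : |F.c E x| ≤ K := (hE x hx).1
          gcongr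
      _ = _ := by ring
  exact ⟨key F.c F.c (fun E' h t ht => (F.growth_of_abs_le hV h ht).1)
      fun E' => (F.sub_eq hV E E' hx).1,
    key F.s F.s (fun E' h t ht => (F.growth_of_abs_le hV h ht).2.2.1)
      fun E' => (F.sub_eq hV E E' hx).2.1⟩

/-- The quadratic form whose integral over a period is `-Δ'(E)`: the upper right entry of the
monodromy matrix based at the point `t`. -/
noncomputable def monodromyForm (E t : ℝ) : ℝ :=
  F.s E p * F.c E t ^ 2 + (F.s' E p - F.c E p) * (F.c E t * F.s E t) - F.c' E p * F.s E t ^ 2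

theorem continuous_monodromyForm (E : ℝ) : Continuous (F.monodromyForm E) := by
  have := F.continuous_c E
  have := F.continuous_s E
  unfold monodromyForm
  fun_prop

theorem hasDerivAt_disc (hp : 0 ≤ p) (hV : BoundedPotential V R) (E : ℝ) :
    HasDerivAt F.disc (-∫ t in 0..p, F.monodromyForm E t) E := by
  set K := Real.exp ((R + (|E| + 1) + 1) * p) with hK
  have hnear : ∀ᶠ E' in 𝓝 E, |E'| ≤ |E| + 1 :=
    continuous_abs.continuousAt.eventually_le_const (lt_add_one _)
  have hE := fun t (ht : t ∈ Icc 0 p) => F.growth_of_abs_le hV (E := E) (N := |E| + 1)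
    (by linarith) ht
  have key : ∀ f g : ℝ → ℝ → ℝ, (∀ t ∈ Icc 0 p, |f E t| ≤ K) →
      (∀ E', |E'| ≤ |E| + 1 → ∀ t ∈ Icc 0 p, |g E' t| ≤ K) →
      (∀ t ∈ Icc 0 p, Tendsto (fun E' => g E' t) (𝓝 E) (𝓝 (g E t))) →
      Continuous (f E) → (∀ E', Continuous (g E')) →
      Tendsto (fun E' => ∫ t in 0..p, f E t * g E' t) (𝓝 E) (𝓝 (∫ t in 0..p, f E t * g E t)) := by
    intro f g hf hg hlim hfc hgc
    refine intervalIntegral.tendsto_integral_filter_of_dominated_convergence (fun _ => K * K)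
      (Eventually.of_forall fun E' => (hfc.mul (hgc E')).aestronglyMeasurable) ?_
      intervalIntegrable_const ?_
    · filter_upwards [hnear] with E' hE'
      refine Eventually.of_forall fun t ht => ?_
      rw [uIoc_of_le hp] at ht
      have ht' : t ∈ Icc 0 p := ⟨ht.1.le, ht.2⟩
      rw [norm_mul]
      exact mul_le_mul (hf t ht') (hg E' hE' t ht') (norm_nonneg _) (Real.exp_pos _).le
    · refine Eventually.of_forall fun t ht => ?_
      rw [uIoc_of_le hp] at ht
      exact (hlim t ⟨ht.1.le, ht.2⟩).const_mul _
  have bc := fun E' h t ht => (F.growth_of_abs_le hV (E := E') (N := |E| + 1) h (x := t) ht).1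
  have bs := fun E' h t ht => (F.growth_of_abs_le hV (E := E') (N := |E| + 1) h (x := t) ht).2.2.1
  have lc := fun t ht => (F.tendsto_of_energy hV E (x := t) ht).1
  have ls := fun t ht => (F.tendsto_of_energy hV E (x := t) ht).2
  have cc := key F.c F.c (fun t ht => (hE t ht).1) bc lc (F.continuous_c E) F.continuous_c
  have cs := key F.c F.s (fun t ht => (hE t ht).1) bs ls (F.continuous_c E) F.continuous_s
  have sc := key F.s F.c (fun t ht => (hE t ht).2.2.1) bc lc (F.continuous_s E) F.continuous_c
  have ss := key F.s F.s (fun t ht => (hE t ht).2.2.1) bs ls (F.continuous_s E) F.continuous_s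
  rw [hasDerivAt_iff_tendsto_slope]
  have hform : -∫ t in 0..p, F.monodromyForm E t =
      -(F.s E p * (∫ t in 0..p, F.c E t * F.c E t) - F.c E p * (∫ t in 0..p, F.s E t * F.c E t) +
        F.s' E p * (∫ t in 0..p, F.c E t * F.s E t) -
        F.c' E p * ∫ t in 0..p, F.s E t * F.s E t) := by
    have hc := F.continuous_c E
    have hs := F.continuous_s E
    rw [← intervalIntegral.integral_const_mul, ← intervalIntegral.integral_const_mul,
      ← intervalIntegral.integral_const_mul, ← intervalIntegral.integral_const_mul,
      ← intervalIntegral.integral_sub, ← intervalIntegral.integral_add,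
      ← intervalIntegral.integral_sub]
    · congr 1
      refine intervalIntegral.integral_congr fun t _ => ?_
      simp only [monodromyForm]; ring
    all_goals exact Continuous.intervalIntegrable (by fun_prop) _ _
  rw [hform]
  refine Tendsto.congr' ?_ (((((cc.const_mul (F.s E p)).sub (sc.const_mul (F.c E p))).add
    (cs.const_mul (F.s' E p))).sub (ss.const_mul (F.c' E p))).neg.mono_left nhdsWithin_le_nhds)
  filter_upwards [self_mem_nhdsWithin] with E' hE'
  have hne : E' - E ≠ 0 := sub_ne_zero.2 hE'
  rw [slope_def_field, F.disc_sub hp hV E E', eq_div_iff hne]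
  ring

theorem continuous_disc (hp : 0 ≤ p) (hV : BoundedPotential V R) : Continuous F.disc :=
  continuous_iff_continuousAt.2 fun E => (F.hasDerivAt_disc hp hV E).continuousAt

/-- Inside the bands, where `|Δ| < 2`, the form `monodromyForm` is definite, its discriminant
being `Δ² - 4`. Hence `Δ` has no critical points there. -/
theorem deriv_disc_ne_zero (hp : 0 < p) (hV : BoundedPotential V R) {E : ℝ}
    (hE : |F.disc E| < 2) : -∫ t in 0..p, F.monodromyForm E t ≠ 0 := by
  have hd := F.det_eq_one hV E (right_mem_Icc.2 hp.le)
  have hlt : F.disc E ^ 2 < 4 := by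
    rw [← sq_abs]; nlinarith [abs_nonneg (F.disc E)]
  have hpos : ∀ t ∈ Ioc 0 p, 0 < F.s E p * F.monodromyForm E t := by
    intro t ht
    have hdt := F.det_eq_one hV E (x := t) ⟨ht.1.le, ht.2⟩
    have e : F.s E p * F.monodromyForm E t =
        (F.s E p * F.c E t + (F.s' E p - F.c E p) / 2 * F.s E t) ^ 2 +
          (4 - F.disc E ^ 2) / 4 * F.s E t ^ 2 := by
      simp only [monodromyForm, disc]
      linear_combination (F.s E t ^ 2) * hd
    rw [e]
    rcases eq_or_ne (F.s E t) 0 with h0 | h0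
    · have hc : F.c E t ≠ 0 := fun h => by simp [h, h0] at hdt
      have hb : F.s E p ≠ 0 := fun h => by
        -- with `s(p) = 0` the eigenvalues `c(p)`, `s'(p)` of the monodromy are real and inverse
        rw [h, mul_zero, sub_zero] at hd
        have : F.disc E ^ 2 = (F.c E p - F.s' E p) ^ 2 + 4 := by
          simp only [disc]; linear_combination 4 * hd
        nlinarith [sq_nonneg (F.c E p - F.s' E p)]
      rw [h0]
      simp only [mul_zero, add_zero]
      positivity
    · have : 0 < (4 - F.disc E ^ 2) / 4 * F.s E t ^ 2 := by
        have : 0 < 4 - F.disc E ^ 2 := by linarith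
        positivity
      positivity
  have hint : 0 < ∫ t in 0..p, F.s E p * F.monodromyForm E t :=
    intervalIntegral.intervalIntegral_pos_of_pos_on
      (((F.continuous_monodromyForm E).const_mul _).intervalIntegrable _ _)
      (fun t ht => hpos t ⟨ht.1, ht.2.le⟩) hp
  rw [intervalIntegral.integral_const_mul] at hint
  intro h
  rw [neg_eq_zero.1 h, mul_zero] at hint
  exact lt_irrefl _ hint

/-! ### Oscillation of the discriminant -/

theorem abs_disc_sub_cos_le (hp : 0 ≤ p) (hV : BoundedPotential V R) (hR : 0 < R) {E : ℝ}
    (hE : R ≤ E) :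
    |F.disc E - 2 * Real.cos (√E * p)| ≤ 2 * (R * (p * Real.exp (3 * √R * p))) / √E := by
  set A := Real.exp (3 * √R * p) with hA
  have hE0 : 0 < E := hR.trans_le hE
  have hw : 0 < √E := Real.sqrt_pos.2 hE0
  have hpp : p ∈ Icc 0 p := right_mem_Icc.2 hp
  have hq := hV.intervalIntegrable E 0 p
  have g := fun t (ht : t ∈ Icc 0 p) => F.growth hV hR (E := E) (by linarith) ht
  rw [max_eq_left hE] at g
  have hB : ∀ᵐ t, |V t - E + √E ^ 2| ≤ R := by
    filter_upwards [hV.bound] with t ht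
    rwa [Real.sq_sqrt hE0.le, sub_add_cancel]
  have int_le : ∀ f : ℝ → ℝ, ∀ C, (∀ t ∈ Icc 0 p, |f t| ≤ C) → ∫ t in 0..p, |f t| ≤ C * p := by
    intro f C hf
    have := abs_integral_mul_le (f := fun t => |f t|) (g := fun _ => 1) (a := C) (b := 1) hp
      (fun t ht => by rw [abs_abs]; exact hf t ht) (fun _ _ => by simp)
    simp only [mul_one] at this
    exact (le_abs_self _).trans this
  have e1 := (F.sol_c E).eq_variation hq hw.ne' hpp
  have e2 := (F.sol_s E).deriv_eq_variation (w := √E) hq hpp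
  simp only [F.c_zero, F.c'_zero, F.s_zero, F.s'_zero] at e1 e2
  have k1 := abs_integral_kernel_le (q := fun t => V t - E) (w := √E) (B := R)
      (κ := fun t => Real.sin (√E * (p - t)) / √E) (C := 1 / √E) hp hB (F.continuous_c E)
      (fun t => by
        rw [abs_div, abs_of_pos hw]; gcongr; exact Real.abs_sin_le_one _)
  have k2 := abs_integral_kernel_le (q := fun t => V t - E) (w := √E) (B := R)
      (κ := fun t => Real.cos (√E * (p - t))) (C := 1) hp hB (F.continuous_s E)
      (fun t => Real.abs_cos_le_one _)
  have i1 := int_le (F.c E) A fun t ht => (g t ht).1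
  have i2 := int_le (F.s E) (A / √E) fun t ht => (g t ht).2.2.1
  have m1 : R * (1 / √E) * ∫ t in 0..p, |F.c E t| ≤ R * (1 / √E) * (A * p) := by gcongr
  have m2 : R * 1 * ∫ t in 0..p, |F.s E t| ≤ R * 1 * (A / √E * p) := by gcongr
  have e3 : F.disc E - 2 * Real.cos (√E * p) =
      (∫ t in 0..p, (V t - E + √E ^ 2) * (F.c E t * (Real.sin (√E * (p - t)) / √E))) +
        ∫ t in 0..p, (V t - E + √E ^ 2) * (F.s E t * Real.cos (√E * (p - t))) := by
    simp only [disc]; linear_combination e1 + e2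
  rw [e3]
  refine (abs_add_le _ _).trans ?_
  calc _ ≤ R * (1 / √E) * (A * p) + R * 1 * (A / √E * p) := by linarith
    _ = _ := by ring

theorem exists_two_le_disc_mul (hp : 0 < p) (hV : BoundedPotential V R) (E₀ σ : ℝ)
    (hσ : σ = 1 ∨ σ = -1) : ∃ E, E₀ < E ∧ 2 ≤ σ * F.disc E := by
  -- `R' > 0` serves as a bound of `V` and `L` makes the error term in the asymptotics small
  set R' := R + 1
  have hR' : 0 < R' := by have := hV.nonneg; positivity
  have hV' : BoundedPotential V R' := hV.mono (by simp [R'])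
  set L := 2 * (R' * (p * Real.exp (3 * √R' * p))) with hL
  have hL0 : 0 < L := by positivity
  obtain ⟨n, hn⟩ := exists_nat_gt (p * (L + |E₀| + R' + 1) / Real.pi)
  have hn' : L + |E₀| + R' + 1 < n * Real.pi / p := by
    rw [div_lt_iff₀ Real.pi_pos] at hn
    rw [lt_div_iff₀ hp]; linarith
  -- at the energies `(jπ/p)²` with `j ≥ n` the discriminant is within `1` of `2 cos (jπ)`
  have approx : ∀ j : ℕ, n ≤ j → |F.disc ((j * Real.pi / p) ^ 2) - 2 * (-1) ^ j| < 1 ∧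
      E₀ < (j * Real.pi / p) ^ 2 := by
    intro j hj
    have hj' : n * Real.pi / p ≤ j * Real.pi / p := by gcongr
    set w := j * Real.pi / p with hw
    have hw1 : L + |E₀| + R' + 1 < w := hn'.trans_le hj'
    have hw0 : 1 < w := by linarith [abs_nonneg E₀]
    have hww : w ≤ w ^ 2 := by nlinarith
    have h1 := F.abs_disc_sub_cos_le hp.le hV' hR' (E := w ^ 2)
      (by linarith [abs_nonneg E₀])
    have h2 : √(w ^ 2) = w := Real.sqrt_sq (by linarith)
    have h3 : w * p = j * Real.pi := by rw [hw]; field_simp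
    rw [h2, h3, Real.cos_nat_mul_pi, ← hL] at h1
    refine ⟨h1.trans_lt ((div_lt_one (by linarith)).2 (by linarith [abs_nonneg E₀])), ?_⟩
    linarith [le_abs_self E₀]
  obtain ⟨j, hj, hjσ⟩ : ∃ j : ℕ, n + 1 ≤ j ∧ (-1 : ℝ) ^ j = σ := by
    rcases hσ with rfl | rfl
    · exact ⟨2 * (n + 1), by omega, by simp⟩
    · exact ⟨2 * (n + 1) + 1, by omega, by simp [pow_succ]⟩
  obtain ⟨i, rfl⟩ : ∃ i, j = i + 1 := ⟨j - 1, by omega⟩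
  have a0 := approx i (by omega)
  have a1 := approx (i + 1) (by omega)
  have a2 := approx (i + 1 + 1) (by omega)
  have hσ2 : σ * σ = 1 := by rcases hσ with rfl | rfl <;> norm_num
  have hi : (-1 : ℝ) ^ i = -σ := by rw [pow_succ] at hjσ; linarith
  have hi2 : (-1 : ℝ) ^ (i + 1 + 1) = -σ := by rw [pow_succ, hjσ]; ring
  rw [hi] at a0
  rw [hjσ] at a1
  rw [hi2] at a2
  set e0 := ((i : ℝ) * Real.pi / p) ^ 2
  set e1 := (((i + 1 : ℕ) : ℝ) * Real.pi / p) ^ 2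
  set e2 := (((i + 1 + 1 : ℕ) : ℝ) * Real.pi / p) ^ 2
  have hpi := Real.pi_pos
  have h01 : e0 < e1 := by
    simp only [e0, e1]; gcongr; simp
  have h12 : e1 < e2 := by
    simp only [e1, e2]; gcongr; simp
  -- the maximum of `σ Δ` between two points where it is negative is a critical point of `Δ`
  obtain ⟨m, hm, hmax⟩ := isCompact_Icc.exists_isMaxOn (nonempty_Icc.2 (h01.trans h12).le)
    (((F.continuous_disc hp.le hV).const_mul σ).continuousOn (s := Icc e0 e2))
  have v0 : σ * F.disc e0 < -1 := by
    have := a0.1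
    rw [abs_lt] at this
    rcases hσ with rfl | rfl <;> linarith
  have v1 : 1 < σ * F.disc e1 := by
    have := a1.1
    rw [abs_lt] at this
    rcases hσ with rfl | rfl <;> linarith
  have v2 : σ * F.disc e2 < -1 := by
    have := a2.1
    rw [abs_lt] at this
    rcases hσ with rfl | rfl <;> linarith
  have vm : 1 < σ * F.disc m := v1.trans_le (hmax ⟨h01.le, h12.le⟩)
  have hm0 : e0 < m := lt_of_le_of_ne hm.1 fun h => by rw [← h] at vm; linarith
  have hm2 : m < e2 := lt_of_le_of_ne hm.2 fun h => by rw [h] at vm; linarith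
  refine ⟨m, a0.2.trans hm0, ?_⟩
  by_contra! hlt
  have hlt' : |F.disc m| < 2 := by
    rw [abs_lt]
    rcases hσ with rfl | rfl <;> constructor <;> linarith
  have hloc : IsLocalMax (fun E => σ * F.disc E) m := hmax.isLocalMax (Icc_mem_nhds hm0 hm2)
  have hz := hloc.hasDerivAt_eq_zero ((F.hasDerivAt_disc hp.le hV m).const_mul σ)
  have hσ0 : σ ≠ 0 := fun h => by rw [h] at hσ2; norm_num at hσ2
  exact F.deriv_disc_ne_zero hp hV hlt' ((mul_eq_zero.1 hz).resolve_left hσ0)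

theorem exists_disc_eq (hp : 0 < p) (hV : BoundedPotential V R) {v : ℝ} (hv : |v| ≤ 2) (E₀ : ℝ) :
    ∃ E, E₀ < E ∧ F.disc E = v := by
  rw [abs_le] at hv
  obtain ⟨a, ha, ha2⟩ := F.exists_two_le_disc_mul hp hV E₀ 1 (Or.inl rfl)
  obtain ⟨b, hb, hb2⟩ := F.exists_two_le_disc_mul hp hV E₀ (-1) (Or.inr rfl)
  have := intermediate_value_uIcc ((F.continuous_disc hp.le hV).continuousOn (s := uIcc a b))
  obtain ⟨E, hE, hEv⟩ := this (show v ∈ uIcc (F.disc a) (F.disc b) from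
    mem_uIcc.2 (Or.inr ⟨by linarith, by linarith⟩))
  exact ⟨E, (lt_min ha hb).trans_le hE.1, hEv⟩

/-! ### Quasi-periodic solutions -/

theorem quadratic_of_quasiperiodic (hp : 0 ≤ p) (hV : BoundedPotential V R) {E : ℝ} {e : ℂ}
    {y y' : ℝ → ℂ} (hy : IsSolution p (fun x => V x - E) y y') (h1 : y p = e * y 0)
    (h2 : y' p = e * y' 0) (h0 : y 0 ≠ 0 ∨ y' 0 ≠ 0) : e ^ 2 - F.disc E * e + 1 = 0 := by
  obtain ⟨a1, a2⟩ := F.eq_of_isSolution hV hy (right_mem_Icc.2 hp)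
  have d : (F.c E p * F.s' E p - F.c' E p * F.s E p : ℂ) = 1 := by
    exact_mod_cast F.det_eq_one hV E (right_mem_Icc.2 hp)
  rw [h1] at a1
  rw [h2] at a2
  simp only [disc, Complex.ofReal_add]
  rcases h0 with h0 | h0
  · refine (mul_eq_zero.1 ?_).resolve_right h0
    linear_combination (y 0) * (-d) + (e - F.s' E p) * a1 + F.s E p * a2
  · refine (mul_eq_zero.1 ?_).resolve_right h0
    linear_combination (y' 0) * (-d) + (e - F.c E p) * a2 + F.c' E p * a1

theorem disc_eq_of_quasiperiodic (hp : 0 ≤ p) (hV : BoundedPotential V R) {E θ : ℝ}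
    {y y' : ℝ → ℂ} (hy : IsSolution p (fun x => V x - E) y y')
    (h1 : y p = Complex.exp (θ * Complex.I) * y 0)
    (h2 : y' p = Complex.exp (θ * Complex.I) * y' 0) (h0 : y 0 ≠ 0 ∨ y' 0 ≠ 0) :
    F.disc E = 2 * Real.cos θ := by
  have h := F.quadratic_of_quasiperiodic hp hV hy h1 h2 h0
  have he : Complex.exp (θ * Complex.I) * Complex.exp (-θ * Complex.I) = 1 := by
    rw [← Complex.exp_add]; simp
  have h3 : (F.disc E : ℂ) = 2 * Complex.cos θ := by
    rw [Complex.cos]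
    linear_combination (-Complex.exp (-θ * Complex.I)) * h +
      (Complex.exp (θ * Complex.I) - F.disc E) * he
  exact_mod_cast h3

theorem exists_quasiperiodic (hp : 0 ≤ p) (hV : BoundedPotential V R) {E θ : ℝ}
    (h : F.disc E = 2 * Real.cos θ) :
    ∃ y y' : ℝ → ℂ, IsSolution p (fun x => V x - E) y y' ∧
      y p = Complex.exp (θ * Complex.I) * y 0 ∧ y' p = Complex.exp (θ * Complex.I) * y' 0 ∧
      (y 0 ≠ 0 ∨ y' 0 ≠ 0) := by
  set e := Complex.exp (θ * Complex.I) with he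
  have he1 : e * Complex.exp (-θ * Complex.I) = 1 := by
    rw [he, ← Complex.exp_add]; simp
  have hd : (F.c E p * F.s' E p - F.c' E p * F.s E p : ℂ) = 1 := by
    exact_mod_cast F.det_eq_one hV E (right_mem_Icc.2 hp)
  have ht : (F.c E p + F.s' E p : ℂ) = e + Complex.exp (-θ * Complex.I) := by
    have : ((F.disc E : ℝ) : ℂ) = 2 * Complex.cos θ := by rw [h]; push_cast; rfl
    rw [Complex.cos, disc] at this
    push_cast at this
    rw [this]; ring
  -- a kernel vector `(a, b)` of the singular matrix `M - e`
  obtain ⟨a, b, hab, r1, r2⟩ : ∃ a b : ℂ, (a ≠ 0 ∨ b ≠ 0) ∧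
      a * F.c E p + b * F.s E p = e * a ∧ a * F.c' E p + b * F.s' E p = e * b := by
    by_cases hb : (F.s E p : ℂ) = 0
    · by_cases hg : (F.s' E p : ℂ) - e = 0
      · refine ⟨0, 1, Or.inr one_ne_zero, by simp [hb], by linear_combination hg⟩
      · refine ⟨e - F.s' E p, F.c' E p, Or.inl fun h => hg (by linear_combination -h), ?_, ?_⟩
        · linear_combination (e * ht - hd + he1)
        · ring
    · refine ⟨F.s E p, e - F.c E p, Or.inl hb, by ring, ?_⟩
      linear_combination (e * ht - hd + he1)
  have hs := (F.sol_c E).ofReal.linearCombination (hV.intervalIntegrable E 0 p)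
    (F.sol_s E).ofReal a b
  refine ⟨_, _, hs, ?_, ?_, ?_⟩
  · simp only [F.c_zero, F.s_zero]; push_cast; linear_combination r1
  · simp only [F.c'_zero, F.s'_zero]; push_cast; linear_combination r2
  · simpa [F.c_zero, F.s_zero, F.c'_zero, F.s'_zero] using hab

/-- If the multiplier `e^{iθ}` is not real, a nonzero quasi-periodic solution has `y'(0) ≠ 0`,
because `c(p)` is real. -/
theorem deriv_zero_ne_zero_of_quasiperiodic (F : FundamentalSystem p V) (hp : 0 ≤ p)
    (hV : BoundedPotential V R) {E θ : ℝ} (hθ : Real.sin θ ≠ 0) {y y' : ℝ → ℂ}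
    (hy : IsSolution p (fun x => V x - E) y y') (hy1 : y p = Complex.exp (θ * Complex.I) * y 0)
    (h0 : y 0 ≠ 0 ∨ y' 0 ≠ 0) : y' 0 ≠ 0 := by
  intro h
  have a1 := (F.eq_of_isSolution hV hy (right_mem_Icc.2 hp)).1
  rw [hy1, h, zero_mul, add_zero, mul_comm] at a1
  have := congrArg Complex.im (mul_left_cancel₀ (h0.resolve_right (not_not.2 h)) a1)
  rw [Complex.exp_ofReal_mul_I_im, Complex.ofReal_im] at this
  exact hθ this

/-- If the multiplier `e^{iθ}` is not real, the quasi-periodic solutions form a line. -/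
theorem quasiperiodic_proportional (F : FundamentalSystem p V) (hp : 0 ≤ p) (hV : BoundedPotential V R) {E θ : ℝ}
    (hθ : Real.sin θ ≠ 0) {y y' z z' : ℝ → ℂ}
    (hy : IsSolution p (fun x => V x - E) y y') (hy1 : y p = Complex.exp (θ * Complex.I) * y 0)
    (hz : IsSolution p (fun x => V x - E) z z') (hz1 : z p = Complex.exp (θ * Complex.I) * z 0) :
    ∀ x ∈ Icc 0 p, z' 0 * y x = y' 0 * z x := by
  have a1 := (F.eq_of_isSolution hV hy (right_mem_Icc.2 hp)).1
  have a2 := (F.eq_of_isSolution hV hz (right_mem_Icc.2 hp)).1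
  rw [hy1] at a1
  rw [hz1] at a2
  have hne : Complex.exp (θ * Complex.I) - F.c E p ≠ 0 := fun h => by
    have := congrArg Complex.im h
    simp [Complex.exp_ofReal_mul_I_im] at this
    exact hθ this
  have hw : z' 0 * y 0 = y' 0 * z 0 := by
    refine mul_left_cancel₀ hne ?_
    linear_combination (z' 0) * a1 - (y' 0) * a2
  intro x hx
  rw [(F.eq_of_isSolution hV hy hx).1, (F.eq_of_isSolution hV hz hx).1]
  linear_combination (F.c E x) * hw

end FundamentalSystem

open Filter Topology in
/-- A solution vanishing on `[0, p]` has zero initial data. -/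
theorem IsSolution.deriv_zero_of_eq_zero {p : ℝ} (hp : 0 < p) {q : ℝ → ℝ} {y y' : ℝ → ℂ}
    (hy : IsSolution p q y y') (h : ∀ x ∈ Ioo 0 p, y x = 0) : y 0 = 0 ∧ y' 0 = 0 := by
  have hy' : ∀ x ∈ Ioo 0 p, y' x = 0 := fun x hx => by
    have h1 : y =ᶠ[𝓝 x] fun _ => 0 :=
      eventually_of_mem (Ioo_mem_nhds hx.1 hx.2) fun t ht => h t ht
    exact (hy.hasDerivAt x).unique ((hasDerivAt_const x (0 : ℂ)).congr_of_eventuallyEq h1)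
  have hcl : (0 : ℝ) ∈ closure (Ioo 0 p) := by
    rw [closure_Ioo hp.ne]; exact left_mem_Icc.2 hp.le
  constructor
  · simpa using map_mem_closure hy.continuous hcl (t := {0}) h
  · simpa using map_mem_closure hy.continuous_deriv hcl (t := {0}) hy'

/-- The energies of quasi-periodic solutions with a unimodular multiplier are bounded below by
`-R`: otherwise `∫ |y'|² + (V - E) |y|²` would be positive, but it is a boundary term that
vanishes. -/
theorem neg_le_of_quasiperiodic {p R : ℝ} {V : ℝ → ℝ} (hp : 0 < p) (hV : BoundedPotential V R)
    {E : ℝ} {e : ℂ} (he : ‖e‖ = 1) {y y' : ℝ → ℂ}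
    (hy : IsSolution p (fun x => V x - E) y y') (h1 : y p = e * y 0) (h2 : y' p = e * y' 0)
    (h0 : y 0 ≠ 0 ∨ y' 0 ≠ 0) : -R ≤ E := by
  by_contra! hE
  have hi := intervalIntegrable_smul (hV.intervalIntegrable E 0 p) hy.continuous
    (right_mem_Icc.2 hp.le)
  have hconj : ∀ t, HasDerivAt (fun t => star (y t)) (star (y' t)) t := fun t =>
    (hy.hasDerivAt t).star
  have h3 := mul_primitive_eq_integral hp.le hconj (continuous_star.comp hy.continuous_deriv) hi
  have hee : star e * e = 1 := by
    have := Complex.conj_mul' e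
    rw [he] at this
    simpa using this
  have hb : star (y p) * (∫ t in 0..p, (V t - E) • y t) =
      star (y 0) * y' 0 - star (y p) * y' 0 := by
    have := hy.deriv_eq p (right_mem_Icc.2 hp.le)
    rw [← sub_eq_iff_eq_add'] at this
    rw [← this, h1, h2, star_mul]
    linear_combination (star (y 0) * y' 0) * hee
  have h4 : ∫ t in 0..p, star (y' t) * ∫ s in 0..t, (V s - E) • y s =
      (∫ t in 0..p, star (y' t) * y' t) - (star (y p) - star (y 0)) * y' 0 := by
    rw [← intervalIntegral.integral_eq_sub_of_hasDerivAt (fun t _ => hconj t)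
      ((continuous_star.comp hy.continuous_deriv).intervalIntegrable _ _),
      ← intervalIntegral.integral_mul_const, ← intervalIntegral.integral_sub
        (f := fun t => star (y' t) * y' t) (g := fun t => star (y' t) * y' 0)
        (((continuous_star.comp hy.continuous_deriv).mul
          hy.continuous_deriv).intervalIntegrable _ _)
        (((continuous_star.comp hy.continuous_deriv).mul
          continuous_const).intervalIntegrable _ _)]
    refine intervalIntegral.integral_congr fun t ht => ?_
    rw [uIcc_of_le hp.le] at ht
    simp only [hy.deriv_eq t ht]; ring
  rw [hb, h4] at h3
  have h5 : (∫ t in 0..p, ‖y' t‖ ^ 2) + ∫ t in 0..p, (V t - E) * ‖y t‖ ^ 2 = 0 := by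
    have e1 : ∫ t in 0..p, star (y' t) * y' t = ((∫ t in 0..p, ‖y' t‖ ^ 2 : ℝ) : ℂ) := by
      rw [← intervalIntegral.integral_ofReal]
      refine intervalIntegral.integral_congr fun t _ => ?_
      simpa using Complex.conj_mul' (y' t)
    have e2 : ∫ t in 0..p, star (y t) * (V t - E) • y t =
        ((∫ t in 0..p, (V t - E) * ‖y t‖ ^ 2 : ℝ) : ℂ) := by
      rw [← intervalIntegral.integral_ofReal]
      refine intervalIntegral.integral_congr fun t _ => ?_
      have := Complex.conj_mul' (y t)
      simp only [Complex.real_smul, Complex.ofReal_mul, Complex.ofReal_pow]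
      rw [← this]; simp; ring
    rw [e1, e2] at h3
    have h6 : (((∫ t in 0..p, ‖y' t‖ ^ 2) + ∫ t in 0..p, (V t - E) * ‖y t‖ ^ 2 : ℝ) : ℂ) = 0 := by
      push_cast
      linear_combination -h3
    exact_mod_cast h6
  have hyc := hy.continuous
  have h7 : 0 ≤ ∫ t in 0..p, ‖y' t‖ ^ 2 :=
    intervalIntegral.integral_nonneg hp.le fun _ _ => by positivity
  have h8 : (-R - E) * ∫ t in 0..p, ‖y t‖ ^ 2 ≤ ∫ t in 0..p, (V t - E) * ‖y t‖ ^ 2 := by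
    rw [← intervalIntegral.integral_const_mul]
    refine intervalIntegral.integral_mono_ae hp.le
      (Continuous.intervalIntegrable (by fun_prop) _ _)
      ((hV.intervalIntegrable E 0 p).mul_continuousOn (by fun_prop)) ?_
    filter_upwards [hV.bound] with t ht
    rw [abs_le] at ht
    gcongr
    exact ht.1
  have h9 : ¬ 0 < ∫ t in 0..p, ‖y t‖ ^ 2 := fun h => by
    have : 0 < (-R - E) * ∫ t in 0..p, ‖y t‖ ^ 2 := mul_pos (by linarith) h
    linarith
  have h10 : ∀ x ∈ Ioo 0 p, y x = 0 := by
    intro x hx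
    by_contra hne
    refine h9 (intervalIntegral.integral_pos hp (Continuous.continuousOn (by fun_prop))
      (fun _ _ => by positivity) ⟨x, ⟨hx.1.le, hx.2.le⟩, by positivity⟩)
  have := hy.deriv_zero_of_eq_zero hp h10
  rcases h0 with h | h
  · exact h this.1
  · exact h this.2

theorem FundamentalSystem.neg_le_of_abs_disc_le {p R : ℝ} {V : ℝ → ℝ} (F : FundamentalSystem p V)
    (hp : 0 < p) (hV : BoundedPotential V R) {E : ℝ} (hE : |F.disc E| ≤ 2) : -R ≤ E := by
  rw [abs_le] at hE
  have h : F.disc E = 2 * Real.cos (Real.arccos (F.disc E / 2)) := by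
    rw [Real.cos_arccos (by linarith) (by linarith)]; ring
  obtain ⟨y, y', hy, h1, h2, h0⟩ := F.exists_quasiperiodic hp.le hV h
  exact neg_le_of_quasiperiodic hp hV (Complex.norm_exp_ofReal_mul_I _) hy h1 h2 h0

/-! ### Level sets of functions without critical values in `(-2, 2)` -/

open Filter Topology

/-- The properties of the discriminant `f = Δ` that determine the band structure: there are no
critical points in the region `|f| < 2`, the region `|f| ≤ 2` is bounded below by `L`, and every
level in `[-2, 2]` is attained at arbitrarily large arguments. -/
structure IsDiscriminant (f f' : ℝ → ℝ) (L : ℝ) : Prop where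
  hasDerivAt : ∀ x, HasDerivAt f (f' x) x
  deriv_ne_zero : ∀ x, |f x| < 2 → f' x ≠ 0
  le_of_abs_le : ∀ x, |f x| ≤ 2 → L ≤ x
  exists_eq : ∀ v, |v| ≤ 2 → ∀ x₀, ∃ x, x₀ < x ∧ f x = v

/-- The points below `x` on the level set `{f = v}`. -/
def levelBelow (f : ℝ → ℝ) (v x : ℝ) : Set ℝ := {z | z < x ∧ f z = v}

namespace IsDiscriminant

variable {f f' : ℝ → ℝ} {L : ℝ} (hf : IsDiscriminant f f' L)

include hf

theorem continuous : Continuous f :=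
  continuous_iff_continuousAt.2 fun x => (hf.hasDerivAt x).continuousAt

/-- Between two points of the same level, `f` has a critical point, hence leaves `(-2, 2)`. -/
theorem exists_two_le_abs {x y : ℝ} (hxy : x < y) (h : f x = f y) :
    ∃ z ∈ Ioo x y, 2 ≤ |f z| := by
  obtain ⟨z, hz, hz'⟩ := exists_hasDerivAt_eq_zero hxy hf.continuous.continuousOn h
    fun t _ => hf.hasDerivAt t
  exact ⟨z, hz, not_lt.1 fun hlt => hf.deriv_ne_zero z hlt hz'⟩

/-- Every point with `|f| < 2` lies in a band: an open interval on which `|f| < 2`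
and which is mapped onto `(-2, 2)` (injectively, by `exists_two_le_abs`). -/
theorem exists_band {e : ℝ} (he : |f e| < 2) :
    ∃ a b, a < e ∧ e < b ∧ (∀ x ∈ Ioo a b, |f x| < 2) ∧
      ∀ v, |v| < 2 → ∃ x ∈ Ioo a b, f x = v := by
  have hc := hf.continuous
  have hcl : IsClosed {x | 2 ≤ |f x|} := isClosed_le continuous_const hc.abs
  set A := {x | 2 ≤ |f x|} ∩ Iic e with hA
  set B := {x | 2 ≤ |f x|} ∩ Ici e with hB
  have hAne : A.Nonempty := by
    refine ⟨min L e - 1, ?_, ?_⟩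
    · by_contra hlt
      have := hf.le_of_abs_le _ (not_le.1 hlt).le
      linarith [min_le_left L e]
    · have := min_le_right L e
      simp only [mem_Iic]; linarith
  have hBne : B.Nonempty := by
    obtain ⟨x, hx, hx2⟩ := hf.exists_eq 2 (by norm_num) e
    exact ⟨x, by simp [hx2], hx.le⟩
  have hAb : BddAbove A := ⟨e, fun x hx => hx.2⟩
  have hBb : BddBelow B := ⟨e, fun x hx => hx.2⟩
  have ha := (hcl.inter isClosed_Iic).csSup_mem hAne hAb
  have hb := (hcl.inter isClosed_Ici).csInf_mem hBne hBb
  set a := sSup A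
  set b := sInf B
  have hae : a < e := lt_of_le_of_ne ha.2 fun h => not_le.2 he (h ▸ ha.1)
  have heb : e < b := lt_of_le_of_ne hb.2 fun h => not_le.2 he (h ▸ hb.1)
  have hab : a < b := hae.trans heb
  have hin : ∀ x ∈ Ioo a b, |f x| < 2 := by
    intro x hx
    by_contra! h
    rcases le_total x e with hxe | hxe
    · exact not_lt.2 (le_csSup hAb ⟨h, hxe⟩) hx.1
    · exact not_lt.2 (csInf_le hBb ⟨h, hxe⟩) hx.2
  have hcle : ∀ x ∈ Icc a b, |f x| ≤ 2 := by
    intro x hx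
    rw [← closure_Ioo hab.ne] at hx
    exact closure_minimal (fun t ht => (hin t ht).le) (isClosed_le hc.abs continuous_const) hx
  have ha2 : |f a| = 2 := le_antisymm (hcle a (left_mem_Icc.2 hab.le)) ha.1
  have hb2 : |f b| = 2 := le_antisymm (hcle b (right_mem_Icc.2 hab.le)) hb.1
  have hne : f a ≠ f b := fun h => by
    obtain ⟨z, hz, hz2⟩ := hf.exists_two_le_abs hab h
    exact not_le.2 (hin z hz) hz2
  refine ⟨a, b, hae, heb, hin, fun v hv => ?_⟩
  rw [abs_lt] at hv
  rcases (abs_eq zero_le_two).1 ha2 with h1 | h1 <;>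
    rcases (abs_eq zero_le_two).1 hb2 with h2 | h2
  · exact absurd (h1.trans h2.symm) hne
  · exact intermediate_value_Ioo' hab.le hc.continuousOn (by rw [h1, h2]; exact hv)
  · exact intermediate_value_Ioo hab.le hc.continuousOn (by rw [h1, h2]; exact hv)
  · exact absurd (h1.trans h2.symm) hne

/-- Below the critical values `±2`, level sets are locally finite. -/
theorem finite_level_le {v : ℝ} (hv : |v| < 2) (x : ℝ) : {z | z ≤ x ∧ f z = v}.Finite := by
  by_contra hinf
  have hsub : {z | z ≤ x ∧ f z = v} ⊆ Icc L x := fun z hz =>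
    ⟨hf.le_of_abs_le z (by rw [hz.2]; exact hv.le), hz.1⟩
  obtain ⟨z, -, hz⟩ := Set.Infinite.exists_accPt_of_subset_isCompact hinf isCompact_Icc hsub
  have hz' : ∃ᶠ y in 𝓝[≠] z, y ∈ {z | z ≤ x ∧ f z = v} := accPt_iff_frequently_nhdsNE.1 hz
  have hfz : f z = v := by
    have hcl : IsClosed {z | f z = v} := isClosed_eq hf.continuous continuous_const
    exact hcl.closure_subset (mem_closure_iff_frequently.2
      ((hz'.filter_mono nhdsWithin_le_nhds).mono fun y hy => hy.2))
  have hne := (hf.hasDerivAt z).eventually_ne (c := v)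
    (hf.deriv_ne_zero z (by rw [hfz]; exact hv))
  obtain ⟨y, hy, hy'⟩ := (hz'.and_eventually hne).exists
  exact hy' hy.2

theorem finite_levelBelow {v : ℝ} (hv : |v| < 2) (x : ℝ) : (levelBelow f v x).Finite :=
  (hf.finite_level_le hv x).subset fun _ hz => ⟨hz.1.le, hz.2⟩

theorem ncard_levelBelow_lt {v x y : ℝ} (hv : |v| < 2) (hx : f x = v) (hxy : x < y) :
    (levelBelow f v x).ncard < (levelBelow f v y).ncard := by
  refine ncard_lt_ncard ⟨fun z hz => ⟨hz.1.trans hxy, hz.2⟩, fun h => ?_⟩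
    (hf.finite_levelBelow hv y)
  exact lt_irrefl _ (h (show x ∈ levelBelow f v y from ⟨hxy, hx⟩)).1

theorem eq_of_ncard_levelBelow_eq {v x y : ℝ} (hv : |v| < 2) (hx : f x = v) (hy : f y = v)
    (h : (levelBelow f v x).ncard = (levelBelow f v y).ncard) : x = y := by
  rcases lt_trichotomy x y with hlt | heq | hlt
  · exact absurd h (hf.ncard_levelBelow_lt hv hx hlt).ne
  · exact heq
  · exact absurd h (hf.ncard_levelBelow_lt hv hy hlt).ne'

/-- Every level in `(-2, 2)` has a point of every rank `n`. -/
theorem exists_ncard_levelBelow_eq {v : ℝ} (hv : |v| < 2) (n : ℕ) :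
    ∃ x, f x = v ∧ (levelBelow f v x).ncard = n := by
  induction n with
  | zero =>
    obtain ⟨X, -, hX⟩ := hf.exists_eq v hv.le 0
    obtain ⟨x, hx, hmin⟩ := exists_min_image _ id (hf.finite_level_le hv X) ⟨X, le_rfl, hX⟩
    refine ⟨x, hx.2, (ncard_eq_zero (hf.finite_levelBelow hv x)).2 ?_⟩
    refine eq_empty_of_forall_notMem fun z hz => ?_
    exact not_lt.2 (hmin z ⟨hz.1.le.trans hx.1, hz.2⟩) hz.1
  | succ n ih =>
    obtain ⟨y, hy, hyn⟩ := ih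
    obtain ⟨X, hyX, hX⟩ := hf.exists_eq v hv.le y
    obtain ⟨x, hx, hmin⟩ := exists_min_image {z | y < z ∧ z ≤ X ∧ f z = v} id
      ((hf.finite_level_le hv X).subset fun z hz => hz.2) ⟨X, hyX, le_rfl, hX⟩
    refine ⟨x, hx.2.2, ?_⟩
    have : levelBelow f v x = insert y (levelBelow f v y) := by
      ext z
      simp only [levelBelow, mem_ofPred_eq, mem_insert_iff]
      constructor
      · rintro ⟨h1, h2⟩
        rcases lt_trichotomy z y with h | h | h
        · exact Or.inr ⟨h, h2⟩
        · exact Or.inl h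
        · exact absurd h1 (not_lt.2 (hmin z ⟨h, h1.le.trans hx.2.1, h2⟩))
      · rintro (rfl | ⟨h1, h2⟩)
        · exact ⟨hx.1, hy⟩
        · exact ⟨h1.trans hx.1, h2⟩
    rw [this, ncard_insert_of_notMem (fun h => lt_irrefl _ h.1) (hf.finite_levelBelow hv y), hyn]

/-- The rank of a point on its level set is at most that of any other point of its band: sending
each point of the first level set to the point of the second one in the same band is injective. -/
theorem ncard_levelBelow_le {v₁ v₂ x₁ x₂ : ℝ} (hv₁ : |v₁| < 2) (hv₂ : |v₂| < 2)
    (hx₁ : f x₁ = v₁) (hx : ∀ t ∈ uIcc x₁ x₂, |f t| < 2) :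
    (levelBelow f v₁ x₁).ncard ≤ (levelBelow f v₂ x₂).ncard := by
  have hw : ∀ z, ∃ w, f z = v₁ → f w = v₂ ∧ ∀ t ∈ uIcc z w, |f t| < 2 := by
    intro z
    by_cases hz : f z = v₁
    · obtain ⟨a, b, h1, h2, h3, h4⟩ := hf.exists_band (e := z) (by rw [hz]; exact hv₁)
      obtain ⟨w, hw, hwv⟩ := h4 v₂ hv₂
      exact ⟨w, fun _ => ⟨hwv, fun t ht => h3 t
        ((ordConnected_Ioo.uIcc_subset ⟨h1, h2⟩ hw) ht)⟩⟩
    · exact ⟨0, fun h => absurd h hz⟩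
  choose W hW using hw
  refine ncard_le_ncard_of_injOn W (fun z hz => ⟨?_, (hW z hz.2).1⟩) ?_
    (hf.finite_levelBelow hv₂ x₂)
  · by_contra! hle
    obtain ⟨t, ht, ht2⟩ := hf.exists_two_le_abs hz.1 (hz.2.trans hx₁.symm)
    refine not_lt.2 ht2 ?_
    rcases le_total t (W z) with h | h
    · exact (hW z hz.2).2 t (mem_uIcc.2 (Or.inl ⟨ht.1.le, h⟩))
    · exact hx t (mem_uIcc.2 (Or.inr ⟨hle.trans h, ht.2.le⟩))
  · have key : ∀ z z', f z = v₁ → f z' = v₁ → W z = W z' → ¬ z < z' := by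
      intro z z' hz hz' h hlt
      obtain ⟨t, ht, ht2⟩ := hf.exists_two_le_abs hlt (hz.trans hz'.symm)
      refine not_lt.2 ht2 ?_
      rcases le_total t (W z) with h' | h'
      · exact (hW z hz).2 t (mem_uIcc.2 (Or.inl ⟨ht.1.le, h'⟩))
      · exact (hW z' hz').2 t (mem_uIcc.2 (Or.inr ⟨h ▸ h', ht.2.le⟩))
    intro z hz z' hz' h
    exact le_antisymm (not_lt.1 (key z' z hz'.2 hz.2 h.symm)) (not_lt.1 (key z z' hz.2 hz'.2 h))

/-- The function sending a level `v ∈ (-2, 2)` to its point of rank `n` is a local inverse of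
`f`. -/
theorem hasDerivAt_of_rank {G : ℝ → ℝ} {n : ℕ}
    (hG : ∀ v, |v| < 2 → f (G v) = v ∧ (levelBelow f v (G v)).ncard = n) {v : ℝ} (hv : |v| < 2) :
    HasDerivAt G (f' (G v))⁻¹ v := by
  have hlev : |f (G v)| < 2 := by rw [(hG v hv).1]; exact hv
  have hnear : ∀ᶠ w in 𝓝 v, |w| < 2 := continuous_abs.continuousAt.eventually_lt_const hv
  obtain ⟨a, b, ha, hb, hin, -⟩ := hf.exists_band hlev
  have huniq : ∀ x ∈ Ioo a b, G (f x) = x := by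
    intro x hx
    have hx2 := hin x hx
    have hsub : ∀ t ∈ uIcc x (G v), |f t| < 2 := fun t ht =>
      hin t (ordConnected_Ioo.uIcc_subset hx ⟨ha, hb⟩ ht)
    refine hf.eq_of_ncard_levelBelow_eq hx2 (hG _ hx2).1 rfl ?_
    rw [(hG _ hx2).2, ← (hG v hv).2]
    refine le_antisymm (hf.ncard_levelBelow_le hv hx2 (hG v hv).1
      (by rwa [uIcc_comm])) (hf.ncard_levelBelow_le hx2 hv rfl hsub)
  have hinj : InjOn f (Ioo a b) := fun x hx y hy h => by
    rw [← huniq x hx, ← huniq y hy, h]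
  have hcont : ContinuousAt G v := by
    intro U hU
    obtain ⟨c, d, hcd, hU'⟩ := mem_nhds_iff_exists_Ioo_subset.1
      (inter_mem hU (Ioo_mem_nhds ha hb))
    obtain ⟨c', hc1, hc2⟩ := exists_between hcd.1
    obtain ⟨d', hd1, hd2⟩ := exists_between hcd.2
    have hlt : c' < d' := hc2.trans hd1
    have hsub : Icc c' d' ⊆ Ioo c d := fun x hx => ⟨hc1.trans_le hx.1, hx.2.trans_lt hd2⟩
    have hcO : ContinuousOn f (Icc c' d') := hf.continuous.continuousOn
    have himg : f '' Ioo c' d' ∈ 𝓝 v := by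
      have hv' := (hG v hv).1
      rcases hcO.strictMonoOn_of_injOn_Icc' hlt.le
          (hinj.mono fun x hx => (hU' (hsub hx)).2) with h | h
      · refine mem_of_superset (Ioo_mem_nhds ?_ ?_) (intermediate_value_Ioo hlt.le hcO)
        · exact hv' ▸ h (left_mem_Icc.2 hlt.le) ⟨hc2.le, hd1.le⟩ hc2
        · exact hv' ▸ h ⟨hc2.le, hd1.le⟩ (right_mem_Icc.2 hlt.le) hd1
      · refine mem_of_superset (Ioo_mem_nhds ?_ ?_) (intermediate_value_Ioo' hlt.le hcO)
        · exact hv' ▸ h ⟨hc2.le, hd1.le⟩ (right_mem_Icc.2 hlt.le) hd1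
        · exact hv' ▸ h (left_mem_Icc.2 hlt.le) ⟨hc2.le, hd1.le⟩ hc2
    refine mem_map.2 (mem_of_superset himg ?_)
    rintro _ ⟨x, hx, rfl⟩
    have hx' := hU' (hsub ⟨hx.1.le, hx.2.le⟩)
    simpa only [mem_preimage, huniq x hx'.2] using hx'.1
  exact HasDerivAt.of_local_left_inverse hcont (hf.hasDerivAt _) (hf.deriv_ne_zero _ hlev)
    (hnear.mono fun w hw => (hG w hw).1)

end IsDiscriminant

theorem FundamentalSystem.isDiscriminant {p R : ℝ} {V : ℝ → ℝ} (F : FundamentalSystem p V)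
    (hp : 0 < p) (hV : BoundedPotential V R) :
    IsDiscriminant F.disc (fun E => -∫ t in 0..p, F.monodromyForm E t) (-R) where
  hasDerivAt := F.hasDerivAt_disc hp.le hV
  deriv_ne_zero _ := F.deriv_disc_ne_zero hp hV
  le_of_abs_le _ := F.neg_le_of_abs_disc_le hp hV
  exists_eq _ hv := F.exists_disc_eq hp hV hv

/-! ### Weak derivatives on the circle -/

section Circle

variable {p : ℝ}

theorem ae_Ioc_iff {P : ℝ → Prop} :
    (∀ᵐ x ∂volume.restrict (Ioc 0 p), P x) ↔ ∀ᵐ x, x ∈ Ioc 0 p → P x :=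
  ae_restrict_iff' measurableSet_Ioc

theorem integral_congr_Ioc {f g : ℝ → ℂ} {x : ℝ} (hx : x ∈ Icc 0 p)
    (h : ∀ᵐ x ∂volume.restrict (Ioc 0 p), f x = g x) :
    ∫ t in 0..x, f t = ∫ t in 0..x, g t := by
  refine intervalIntegral.integral_congr_ae ?_
  filter_upwards [ae_Ioc_iff.1 h] with t ht ht'
  rw [uIoc_of_le hx.1] at ht'
  exact ht ⟨ht'.1, ht'.2.trans hx.2⟩

theorem memLp_of_continuous {f : ℝ → ℂ} (hf : Continuous f) :
    MemLp f 2 (volume.restrict (Ioc 0 p)) := by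
  obtain ⟨C, hC⟩ := isCompact_Icc.exists_bound_of_continuousOn (hf.continuousOn (s := Icc 0 p))
  refine MemLp.of_bound hf.aestronglyMeasurable C ?_
  exact (ae_restrict_iff' measurableSet_Ioc).2
    (Filter.Eventually.of_forall fun x hx => hC x ⟨hx.1.le, hx.2⟩)

theorem contDiff_fourier (n : ℤ) :
    ContDiff ℝ ∞ (fun x : ℝ => fourier n (x : AddCircle p)) := by
  simp only [fourier_coe_apply]
  have : ContDiff ℝ ∞ (fun x : ℝ => (x : ℂ)) := Complex.ofRealCLM.contDiff
  fun_prop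

theorem periodic_fourier (n : ℤ) :
    Function.Periodic (fun x : ℝ => fourier n (x : AddCircle p)) p := fun x => by simp

variable [hp : Fact (0 < p)]

theorem ae_Ioc_of_ae {P : AddCircle p → Prop} (h : ∀ᵐ t, P t) :
    ∀ᵐ x : ℝ ∂volume.restrict (Ioc 0 p), P (x : AddCircle p) := by
  have := (AddCircle.measurePreserving_mk p 0).quasiMeasurePreserving.ae h
  rwa [zero_add] at this

theorem intervalIntegrable_L2 (u : L2 p) (a b : ℝ) :
    IntervalIntegrable (fun x : ℝ => u (x : AddCircle p)) volume a b := by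
  have h1 : Integrable u := (Lp.memLp u).integrable (by norm_num)
  have h2 := (AddCircle.measurePreserving_mk p 0).integrable_comp_of_integrable h1
  have h3 : IntervalIntegrable (fun x : ℝ => u (x : AddCircle p)) volume 0 (0 + p) :=
    (intervalIntegrable_iff_integrableOn_Ioc_of_le (by linarith [hp.out])).2 h2
  exact Function.Periodic.intervalIntegrable (T := p)
    (fun x => by simp) hp.out.ne' h3 a b

/-- The element of `L²(𝕋)` given by a function on the fundamental domain `(0, p]`. -/
noncomputable def toL2 (f : ℝ → ℂ) (hf : MemLp f 2 (volume.restrict (Ioc 0 p))) : L2 p :=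
  MemLp.toLp (AddCircle.liftIoc p 0 f) (MemLp.memLp_liftIoc (by rwa [zero_add]))

theorem coeFn_toL2 {f : ℝ → ℂ} (hf : MemLp f 2 (volume.restrict (Ioc 0 p))) :
    toL2 f hf =ᵐ[volume] AddCircle.liftIoc p 0 f :=
  MemLp.coeFn_toLp _

theorem toL2_ae {f : ℝ → ℂ} (hf : MemLp f 2 (volume.restrict (Ioc 0 p))) :
    ∀ᵐ x : ℝ ∂volume.restrict (Ioc 0 p), toL2 f hf (x : AddCircle p) = f x := by
  filter_upwards [ae_Ioc_of_ae (coeFn_toL2 hf), ae_restrict_mem measurableSet_Ioc] with x hx hx'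
  rw [hx, AddCircle.liftIoc_zero_coe_apply hx']

/-- A square integrable function on the circle whose nonconstant Fourier coefficients vanish is
constant. -/
theorem ae_const_of_integral_fourier {f : AddCircle p → ℂ} (hf : MemLp f 2 volume)
    (h : ∀ n : ℤ, n ≠ 0 → ∫ x in 0..p, fourier n (x : AddCircle p) * f x = 0) :
    ∃ C : ℂ, ∀ᵐ t, f t = C := by
  have hf' : MemLp f 2 AddCircle.haarAddCircle := hf.haarAddCircle
  set g := hf'.toLp f with hg
  have hgf : g =ᵐ[AddCircle.haarAddCircle] f := MemLp.coeFn_toLp hf'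
  have hcoef : ∀ n : ℤ, n ≠ 0 → fourierCoeff g n = 0 := by
    intro n hn
    rw [fourierCoeff_congr_ae hgf, fourierCoeff_eq_intervalIntegral f n 0, zero_add]
    have := h (-n) (neg_ne_zero.2 hn)
    simp only [smul_eq_mul, this, smul_zero]
  have hs := hasSum_fourier_series_L2 g
  have hs' := hasSum_single (f := fun i => fourierCoeff g i • fourierLp (T := p) 2 i) 0
    fun n hn => by rw [hcoef n hn, zero_smul]
  have hgC : g = fourierCoeff g 0 • fourierLp 2 0 := hs.unique hs'
  refine ⟨fourierCoeff g 0, ?_⟩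
  have h1 : ∀ᵐ t ∂AddCircle.haarAddCircle, f t = fourierCoeff g 0 := by
    have h2 : (g : AddCircle p → ℂ) =ᵐ[AddCircle.haarAddCircle]
        (fourierCoeff g 0 • fourierLp (T := p) 2 0 : Lp ℂ 2 AddCircle.haarAddCircle) := by
      rw [← hgC]
    filter_upwards [hgf, h2, Lp.coeFn_smul (fourierCoeff g 0) (fourierLp (T := p) 2 0),
      coeFn_fourierLp (T := p) 2 0] with t a1 a2 a3 a4
    rw [← a1, a2, a3, Pi.smul_apply, a4, fourier_zero, smul_eq_mul, mul_one]
  rw [AddCircle.volume_eq_smul_haarAddCircle]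
  exact Measure.ae_smul_measure h1 _

theorem IsWeakDeriv.integral_eq_zero {u v : L2 p} (h : IsWeakDeriv p u v) :
    ∫ x in (0 : ℝ)..p, v (x : AddCircle p) = 0 := by
  have := h (fun _ => 1) contDiff_const fun _ => rfl
  simpa using this.symm

/-- A function with a weak derivative in `L²` is the primitive of its weak derivative. -/
theorem IsWeakDeriv.ae_eq_primitive {u v : L2 p} (h : IsWeakDeriv p u v) :
    ∃ C : ℂ, ∀ᵐ x : ℝ ∂volume.restrict (Ioc 0 p),
      u (x : AddCircle p) = C + ∫ t in 0..x, v (t : AddCircle p) := by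
  have hvi := intervalIntegrable_L2 v
  have hU : Continuous fun x : ℝ => ∫ t in 0..x, v (t : AddCircle p) :=
    intervalIntegral.continuous_primitive hvi 0
  set U : ℝ → ℂ := fun x : ℝ => ∫ t in 0..x, v (t : AddCircle p) with hUdef
  have hf : MemLp (fun t => u t - AddCircle.liftIoc p 0 U t) 2 volume :=
    (Lp.memLp u).sub (MemLp.memLp_liftIoc (by rw [zero_add]; exact memLp_of_continuous hU))
  have hcoef : ∀ n : ℤ, n ≠ 0 → ∫ x in 0..p, fourier n (x : AddCircle p) *
      (fun t => u t - AddCircle.liftIoc p 0 U t) x = 0 := by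
    intro n hn
    have hd := fun x : ℝ => hasDerivAt_fourier p n x
    set κ : ℂ := 2 * Real.pi * Complex.I * n / p with hκ
    have hκ0 : κ ≠ 0 := by
      have := hp.out.ne'
      simp [hκ, hn, Real.pi_ne_zero, this]
    have hfc : Continuous fun x : ℝ => fourier n (x : AddCircle p) :=
      (contDiff_fourier n).continuous
    have h1 := h _ (contDiff_fourier n) (periodic_fourier n)
    have h2 := mul_primitive_eq_integral hp.out.le hd (hfc.const_mul κ) (hvi 0 p)
    rw [h.integral_eq_zero, mul_zero] at h2
    have h3 : ∀ x : ℝ, deriv (fun x : ℝ => fourier n (x : AddCircle p)) x =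
        κ * fourier n (x : AddCircle p) := fun x => (hd x).deriv
    have h4 : ∫ x in (0 : ℝ)..p, v (x : AddCircle p) * fourier n (x : AddCircle p) =
        ∫ x in (0 : ℝ)..p, fourier n (x : AddCircle p) * v (x : AddCircle p) := by
      simp only [mul_comm]
    simp only [h3] at h1
    rw [h4] at h1
    have h5 : κ * ∫ x in 0..p, fourier n (x : AddCircle p) *
        (fun t => u t - AddCircle.liftIoc p 0 U t) x =
        (∫ x in (0 : ℝ)..p, u (x : AddCircle p) * (κ * fourier n (x : AddCircle p))) -
          ∫ x in (0 : ℝ)..p, κ * fourier n (x : AddCircle p) * U x := by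
      rw [← intervalIntegral.integral_sub
        ((intervalIntegrable_L2 u 0 p).mul_continuousOn (by fun_prop))
        (Continuous.intervalIntegrable (by fun_prop) _ _), ← intervalIntegral.integral_const_mul]
      refine intervalIntegral.integral_congr_ae (Filter.Eventually.of_forall fun x hx => ?_)
      rw [uIoc_of_le hp.out.le] at hx
      simp only [AddCircle.liftIoc_zero_coe_apply hx]
      ring
    have h6 : κ * ∫ x in 0..p, fourier n (x : AddCircle p) *
        (fun t => u t - AddCircle.liftIoc p 0 U t) x = 0 := by
      rw [h5, h1]; linear_combination h2
    exact (mul_eq_zero.1 h6).resolve_left hκ0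
  obtain ⟨C, hC⟩ := ae_const_of_integral_fourier hf hcoef
  refine ⟨C, ?_⟩
  filter_upwards [ae_Ioc_of_ae hC, ae_restrict_mem measurableSet_Ioc] with x hx hx'
  rw [AddCircle.liftIoc_zero_coe_apply hx'] at hx
  linear_combination hx

theorem coeFn_zero_ae :
    ∀ᵐ x : ℝ ∂volume.restrict (Ioc 0 p), (0 : L2 p) (x : AddCircle p) = 0 :=
  ae_Ioc_of_ae (Lp.coeFn_zero ℂ 2 (volume : Measure (AddCircle p)))

theorem isWeakDeriv_zero : IsWeakDeriv p 0 0 := by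
  intro φ _ _
  have e : ∀ f : ℝ → ℂ, ∫ x in (0 : ℝ)..p, (0 : L2 p) (x : AddCircle p) * f x = 0 := fun f => by
    rw [integral_congr_Ioc (g := fun _ => 0) (right_mem_Icc.2 hp.out.le)
      (coeFn_zero_ae.mono fun x hx => by rw [hx, zero_mul]), intervalIntegral.integral_zero]
  rw [e, e, neg_zero]

theorem IsWeakDeriv.eq_zero {v : L2 p} (h : IsWeakDeriv p 0 v) : v = 0 := by
  obtain ⟨C, hC⟩ := ae_const_of_integral_fourier (Lp.memLp v) fun n _ => by
    have h1 := h _ (contDiff_fourier n) (periodic_fourier n)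
    rw [integral_congr_Ioc (g := fun _ => 0) (right_mem_Icc.2 hp.out.le)
      (coeFn_zero_ae.mono fun x hx => by rw [hx, zero_mul])] at h1
    simp only [intervalIntegral.integral_zero] at h1
    rw [← neg_eq_zero, h1]
    simp only [mul_comm]
  have h2 := h.integral_eq_zero
  rw [integral_congr_Ioc (g := fun _ => C) (right_mem_Icc.2 hp.out.le) (ae_Ioc_of_ae hC)] at h2
  have hC0 : C = 0 := by
    simpa [hp.out.ne'] using h2
  rw [Lp.eq_zero_iff_ae_eq_zero]
  filter_upwards [hC] with t ht
  rw [ht, hC0]; rfl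

theorem hasDerivAt_exp_mul_I (k x : ℝ) :
    HasDerivAt (fun x : ℝ => Complex.exp ((k * x : ℝ) * Complex.I))
      (k * Complex.I * Complex.exp ((k * x : ℝ) * Complex.I)) x := by
  have h : HasDerivAt (fun x : ℝ => (((k * x : ℝ) : ℂ) * Complex.I)) (k * Complex.I) x := by
    have := (((hasDerivAt_id x).const_mul k).ofReal_comp).mul_const Complex.I
    simpa using! this
  convert! h.cexp using 1
  ring

/-- Gauge transformation: `g = (D + k) u` says that `e^{ikx} u` is quasi-periodic with derivative
`i e^{ikx} g`. -/
theorem ShiftedMomentum.ae_eq_primitive {k : ℝ} {u g : L2 p} (h : ShiftedMomentum p k u g) :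
    ∃ C : ℂ, (∀ᵐ x : ℝ ∂volume.restrict (Ioc 0 p),
      Complex.exp ((k * x : ℝ) * Complex.I) * u (x : AddCircle p) =
        C + ∫ t in 0..x, Complex.I * Complex.exp ((k * t : ℝ) * Complex.I) * g (t : AddCircle p)) ∧
      C + ∫ t in 0..p, Complex.I * Complex.exp ((k * t : ℝ) * Complex.I) * g (t : AddCircle p) =
        Complex.exp ((k * p : ℝ) * Complex.I) * C := by
  obtain ⟨v, hv, rfl⟩ := h
  obtain ⟨C, hC⟩ := hv.ae_eq_primitive
  have hec : Continuous fun x : ℝ => Complex.exp ((k * x : ℝ) * Complex.I) := by fun_prop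
  have hvi := intervalIntegrable_L2 v
  have hU : Continuous fun x : ℝ => ∫ t in 0..x, v (t : AddCircle p) :=
    intervalIntegral.continuous_primitive hvi 0
  have hg : ∀ᵐ x : ℝ ∂volume.restrict (Ioc 0 p),
      Complex.I * Complex.exp ((k * x : ℝ) * Complex.I) *
        ((-Complex.I) • v + (k : ℂ) • u : L2 p) (x : AddCircle p) =
      k * Complex.I * Complex.exp ((k * x : ℝ) * Complex.I) * C +
        (k * Complex.I * Complex.exp ((k * x : ℝ) * Complex.I) * ∫ t in 0..x, v (t : AddCircle p)) +
        Complex.exp ((k * x : ℝ) * Complex.I) * v (x : AddCircle p) := by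
    filter_upwards [hC, ae_Ioc_of_ae (Lp.coeFn_add ((-Complex.I) • v) ((k : ℂ) • u)),
      ae_Ioc_of_ae (Lp.coeFn_smul (-Complex.I) v), ae_Ioc_of_ae (Lp.coeFn_smul (k : ℂ) u)]
      with x a1 a2 a3 a4
    rw [a2, Pi.add_apply, a3, a4, Pi.smul_apply, Pi.smul_apply, a1, smul_eq_mul, smul_eq_mul]
    linear_combination (-Complex.exp ((k * x : ℝ) * Complex.I) * v (x : AddCircle p)) *
      Complex.I_mul_I
  have key : ∀ x ∈ Icc 0 p, C + ∫ t in 0..x, Complex.I * Complex.exp ((k * t : ℝ) * Complex.I) *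
      ((-Complex.I) • v + (k : ℂ) • u : L2 p) (t : AddCircle p) =
      Complex.exp ((k * x : ℝ) * Complex.I) * (C + ∫ t in 0..x, v (t : AddCircle p)) := by
    intro x hx
    rw [integral_congr_Ioc hx hg, intervalIntegral.integral_add, intervalIntegral.integral_add]
    · have h1 := mul_primitive_eq_integral hx.1 (hasDerivAt_exp_mul_I k) (by fun_prop) (hvi 0 x)
      have h2 := intervalIntegral.integral_eq_sub_of_hasDerivAt
        (fun t _ => hasDerivAt_exp_mul_I k t)
        (Continuous.intervalIntegrable (u := fun t : ℝ => k * Complex.I *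
          Complex.exp ((k * t : ℝ) * Complex.I)) (by fun_prop) 0 x)
      rw [intervalIntegral.integral_mul_const, h2, mul_add, h1]
      simp
      ring
    · exact Continuous.intervalIntegrable (by fun_prop) _ _
    · exact Continuous.intervalIntegrable (by fun_prop) _ _
    · exact Continuous.intervalIntegrable (by fun_prop) _ _
    · exact (hvi 0 x).continuousOn_mul (by fun_prop)
  refine ⟨C, ?_, ?_⟩
  · filter_upwards [hC, ae_restrict_mem measurableSet_Ioc] with x hx hx'
    rw [key x ⟨hx'.1.le, hx'.2⟩, hx]
  · rw [key p (right_mem_Icc.2 hp.out.le), hv.integral_eq_zero, add_zero]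

/-- The converse of `ShiftedMomentum.ae_eq_primitive`. -/
theorem shiftedMomentum_of_primitive {k : ℝ} {u g : L2 p} {ψ ψ' : ℝ → ℂ}
    (hψc : Continuous ψ) (hψ' : IntervalIntegrable ψ' volume 0 p)
    (hψ : ∀ x ∈ Icc 0 p, ψ x = ψ 0 + ∫ t in 0..x, ψ' t)
    (hqp : ψ p = Complex.exp ((k * p : ℝ) * Complex.I) * ψ 0)
    (hu : ∀ᵐ x : ℝ ∂volume.restrict (Ioc 0 p),
      Complex.exp ((k * x : ℝ) * Complex.I) * u (x : AddCircle p) = ψ x)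
    (hg : ∀ᵐ x : ℝ ∂volume.restrict (Ioc 0 p),
      Complex.I * Complex.exp ((k * x : ℝ) * Complex.I) * g (x : AddCircle p) = ψ' x) :
    ShiftedMomentum p k u g := by
  refine ⟨Complex.I • g - (Complex.I * k) • u, ?_, ?_⟩
  · intro φ hφ hper
    have hpp := right_mem_Icc.2 hp.out.le
    have hφd : ∀ x, HasDerivAt φ (deriv φ x) x := fun x =>
      (hφ.differentiable (by simp) x).hasDerivAt
    have hφc : Continuous (deriv φ) := hφ.continuous_deriv (by simp)
    have hφ0 : Continuous φ := hφ.continuous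
    have hexp : ∀ x : ℝ, Complex.exp ((-k * x : ℝ) * Complex.I) *
        Complex.exp ((k * x : ℝ) * Complex.I) = 1 := fun x => by
      rw [← Complex.exp_add]; simp
    have hfd := fun x => (hasDerivAt_exp_mul_I (-k) x).mul (hφd x)
    have hfc : Continuous fun x : ℝ =>
        (((-k : ℝ) : ℂ) * Complex.I * Complex.exp ((-k * x : ℝ) * Complex.I)) * φ x +
          Complex.exp ((-k * x : ℝ) * Complex.I) * deriv φ x := by fun_prop
    have h1 := mul_primitive_eq_integral hp.out.le hfd hfc hψ'
    have h2 := intervalIntegral.integral_eq_sub_of_hasDerivAt (fun x _ => hfd x)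
      (hfc.intervalIntegrable 0 p)
    have h3 : ∫ t in 0..p, ((((-k : ℝ) : ℂ) * Complex.I *
        Complex.exp ((-k * t : ℝ) * Complex.I)) * φ t +
          Complex.exp ((-k * t : ℝ) * Complex.I) * deriv φ t) * ∫ s in 0..t, ψ' s =
        (∫ t in 0..p, ((((-k : ℝ) : ℂ) * Complex.I *
        Complex.exp ((-k * t : ℝ) * Complex.I)) * φ t +
          Complex.exp ((-k * t : ℝ) * Complex.I) * deriv φ t) * ψ t) -
        (∫ t in 0..p, ((((-k : ℝ) : ℂ) * Complex.I *
        Complex.exp ((-k * t : ℝ) * Complex.I)) * φ t +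
          Complex.exp ((-k * t : ℝ) * Complex.I) * deriv φ t)) * ψ 0 := by
      rw [← intervalIntegral.integral_mul_const, ← intervalIntegral.integral_sub
        (Continuous.intervalIntegrable (by fun_prop) _ _)
        (Continuous.intervalIntegrable (by fun_prop) _ _)]
      refine intervalIntegral.integral_congr fun t ht => ?_
      rw [uIcc_of_le hp.out.le] at ht
      simp only [hψ t ht]; ring
    have h4 : ∫ t in 0..p, ψ' t = (Complex.exp ((k * p : ℝ) * Complex.I) - 1) * ψ 0 := by
      have := hψ p hpp
      rw [hqp] at this
      linear_combination -this
    have h5 : (∫ t in 0..p, ((((-k : ℝ) : ℂ) * Complex.I *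
        Complex.exp ((-k * t : ℝ) * Complex.I)) * φ t +
          Complex.exp ((-k * t : ℝ) * Complex.I) * deriv φ t) * ψ t) +
        ∫ t in 0..p, (Complex.exp ((-k * t : ℝ) * Complex.I) * φ t) * ψ' t = 0 := by
      have hφp : φ p = φ 0 := by simpa using hper 0
      rw [h3, h2, h4] at h1
      simp only [Pi.mul_apply, hφp, mul_zero, Complex.ofReal_zero, zero_mul,
        Complex.exp_zero] at h1
      linear_combination (-h1) + (φ 0 * ψ 0) * hexp p
    have h6 : (∫ x in (0 : ℝ)..p, u (x : AddCircle p) * deriv φ x) +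
        ∫ x in (0 : ℝ)..p, (Complex.I • g - (Complex.I * k) • u : L2 p) (x : AddCircle p) * φ x =
        0 := by
      rw [← h5, ← intervalIntegral.integral_add, ← intervalIntegral.integral_add]
      · refine integral_congr_Ioc hpp ?_
        filter_upwards [hu, hg, ae_Ioc_of_ae (Lp.coeFn_sub (Complex.I • g) ((Complex.I * k) • u)),
          ae_Ioc_of_ae (Lp.coeFn_smul Complex.I g),
          ae_Ioc_of_ae (Lp.coeFn_smul (Complex.I * (k : ℂ)) u)] with x a1 a2 a3 a4 a5
        rw [a3, Pi.sub_apply, a4, a5, Pi.smul_apply, Pi.smul_apply, ← a1, ← a2, smul_eq_mul,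
          smul_eq_mul]
        push_cast
        have := hexp x
        push_cast at this
        linear_combination (-(u (x : AddCircle p) * deriv φ x +
          (Complex.I * g (x : AddCircle p) - Complex.I * k * u (x : AddCircle p)) * φ x)) * this
      · exact Continuous.intervalIntegrable (by fun_prop) _ _
      · exact hψ'.continuousOn_mul (by fun_prop)
      · exact (intervalIntegrable_L2 _ _ _).mul_continuousOn (by fun_prop)
      · exact (intervalIntegrable_L2 _ _ _).mul_continuousOn (by fun_prop)
    linear_combination h6
  · simp only [smul_sub, smul_smul]
    rw [← mul_assoc]
    simp

/-! ### Eigenfunctions as quasi-periodic solutions -/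

theorem FiberOperator.exists_solution {V : ℝ → ℝ} (hVp : Function.Periodic V p) {k μ : ℝ}
    {u : L2 p} (h : FiberOperator p hVp.lift k u ((μ : ℂ) • u)) :
    ∃ y y' : ℝ → ℂ, IsSolution p (fun x => V x - μ) y y' ∧
      y p = Complex.exp ((k * p : ℝ) * Complex.I) * y 0 ∧
      y' p = Complex.exp ((k * p : ℝ) * Complex.I) * y' 0 ∧
      ∀ᵐ x : ℝ ∂volume.restrict (Ioc 0 p),
        Complex.exp ((k * x : ℝ) * Complex.I) * u (x : AddCircle p) = y x := by
  obtain ⟨g, w, hug, hgw, hf⟩ := h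
  obtain ⟨C₁, h1, h1p⟩ := hug.ae_eq_primitive
  obtain ⟨C₂, h2, h2p⟩ := hgw.ae_eq_primitive
  have hec : Continuous fun x : ℝ => Complex.exp ((k * x : ℝ) * Complex.I) := by fun_prop
  have hwi : ∀ a b, IntervalIntegrable (fun t : ℝ => Complex.I *
      Complex.exp ((k * t : ℝ) * Complex.I) * w (t : AddCircle p)) volume a b := fun a b =>
    (intervalIntegrable_L2 w a b).continuousOn_mul (by fun_prop)
  set X : ℝ → ℂ := fun x => C₂ + ∫ t in 0..x, Complex.I *
    Complex.exp ((k * t : ℝ) * Complex.I) * w (t : AddCircle p) with hX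
  have hXc : Continuous X := (intervalIntegral.continuous_primitive hwi 0).const_add C₂
  have hX0 : X 0 = C₂ := by simp [hX]
  have hy : ∀ x ∈ Icc 0 p, C₁ + ∫ t in 0..x, Complex.I * X t = C₁ + ∫ t in 0..x, Complex.I *
      Complex.exp ((k * t : ℝ) * Complex.I) * g (t : AddCircle p) := fun x hx => by
    rw [integral_congr_Ioc hx (h2.mono fun t ht => ?_)]
    rw [mul_assoc, ht]
  have hyu : ∀ᵐ x : ℝ ∂volume.restrict (Ioc 0 p),
      Complex.exp ((k * x : ℝ) * Complex.I) * u (x : AddCircle p) =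
        C₁ + ∫ t in 0..x, Complex.I * X t := by
    filter_upwards [h1, ae_restrict_mem measurableSet_Ioc] with x hx hx'
    rw [hx, hy x ⟨hx'.1.le, hx'.2⟩]
  have hXi : Continuous fun t => Complex.I * X t := hXc.const_mul _
  refine ⟨fun x => C₁ + ∫ t in 0..x, Complex.I * X t, fun x => Complex.I * X x,
    ⟨fun x => ?_, hXi, fun x hx => ?_⟩, ?_, ?_, hyu⟩
  · exact (intervalIntegral.integral_hasDerivAt_right (hXi.intervalIntegrable 0 x)
      (hXi.stronglyMeasurableAtFilter _ _) hXi.continuousAt).const_add C₁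
  · have hq : ∀ᵐ x : ℝ ∂volume.restrict (Ioc 0 p),
        Complex.I * (Complex.I * Complex.exp ((k * x : ℝ) * Complex.I) * w (x : AddCircle p)) =
          (V x - μ) • (C₁ + ∫ t in 0..x, Complex.I * X t) := by
      filter_upwards [hyu, ae_Ioc_of_ae hf, ae_Ioc_of_ae (Lp.coeFn_smul (μ : ℂ) u)]
        with x a1 a2 a3
      rw [← a1, Complex.real_smul]
      rw [a3, Pi.smul_apply, smul_eq_mul, Function.Periodic.lift_coe] at a2
      push_cast
      linear_combination (Complex.exp (k * x * Complex.I) * w (x : AddCircle p)) *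
        Complex.I_mul_I + Complex.exp (k * x * Complex.I) * a2
    rw [← integral_congr_Ioc hx hq, intervalIntegral.integral_const_mul, hX0]
    simp only [hX]
    ring
  · simp only [intervalIntegral.integral_same, add_zero]
    rw [hy p (right_mem_Icc.2 hp.out.le), h1p]
  · simp only [hX0]
    have : X p = Complex.exp ((k * p : ℝ) * Complex.I) * C₂ := h2p
    rw [this]; ring

theorem exists_fiberOperator_of_solution {V : ℝ → ℝ} {R : ℝ} (hVp : Function.Periodic V p)
    (hV : BoundedPotential V R) {k μ : ℝ} {y y' : ℝ → ℂ}
    (hy : IsSolution p (fun x => V x - μ) y y')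
    (h1 : y p = Complex.exp ((k * p : ℝ) * Complex.I) * y 0)
    (h2 : y' p = Complex.exp ((k * p : ℝ) * Complex.I) * y' 0) :
    ∃ u : L2 p, FiberOperator p hVp.lift k u ((μ : ℂ) • u) ∧
      ∀ᵐ x : ℝ ∂volume.restrict (Ioc 0 p),
        Complex.exp ((k * x : ℝ) * Complex.I) * u (x : AddCircle p) = y x := by
  have hexp : ∀ x : ℝ, Complex.exp ((k * x : ℝ) * Complex.I) *
      Complex.exp ((-k * x : ℝ) * Complex.I) = 1 := fun x => by
    rw [← Complex.exp_add]; simp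
  have hec : Continuous fun x : ℝ => Complex.exp ((-k * x : ℝ) * Complex.I) := by fun_prop
  have hyc := hy.continuous
  have hyc' := hy.continuous_deriv
  have hqi := fun a b => hV.intervalIntegrable μ a b
  have m1 : MemLp (fun x : ℝ => Complex.exp ((-k * x : ℝ) * Complex.I) * y x) 2
      (volume.restrict (Ioc 0 p)) := memLp_of_continuous (by fun_prop)
  have m2 : MemLp (fun x : ℝ => -Complex.I * (Complex.exp ((-k * x : ℝ) * Complex.I) * y' x)) 2
      (volume.restrict (Ioc 0 p)) := memLp_of_continuous (by fun_prop)
  have m3 : MemLp (fun x : ℝ => -((V x - μ) • (Complex.exp ((-k * x : ℝ) * Complex.I) * y x))) 2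
      (volume.restrict (Ioc 0 p)) := by
    have hc : Continuous fun x : ℝ => Complex.exp ((-k * x : ℝ) * Complex.I) * y x := by fun_prop
    obtain ⟨C, hC⟩ := isCompact_Icc.exists_bound_of_continuousOn (hc.continuousOn (s := Icc 0 p))
    have hb := hV.sub_const μ
    refine MemLp.of_bound ((hb.meas.restrict.smul hc.aestronglyMeasurable).neg)
      ((R + |μ|) * C) ?_
    filter_upwards [ae_restrict_of_ae hb.bound, ae_restrict_mem measurableSet_Ioc] with x hx hx'
    rw [norm_neg, norm_smul]
    exact mul_le_mul hx (hC x ⟨hx'.1.le, hx'.2⟩) (norm_nonneg _) ((abs_nonneg _).trans hx)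
  have e1 := toL2_ae m1
  have e2 := toL2_ae m2
  have e3 := toL2_ae m3
  have hu : ∀ᵐ x : ℝ ∂volume.restrict (Ioc 0 p),
      Complex.exp ((k * x : ℝ) * Complex.I) * toL2 _ m1 (x : AddCircle p) = y x := by
    filter_upwards [e1] with x hx
    rw [hx, ← mul_assoc, hexp, one_mul]
  refine ⟨toL2 _ m1, ⟨toL2 _ m2, toL2 _ m3, ?_, ?_, ?_⟩, hu⟩
  · refine shiftedMomentum_of_primitive hyc (hyc'.intervalIntegrable 0 p) (fun x _ => ?_) h1 hu ?_
    · rw [intervalIntegral.integral_eq_sub_of_hasDerivAt (fun t _ => hy.hasDerivAt t)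
        (hyc'.intervalIntegrable _ _)]
      ring
    · filter_upwards [e2] with x hx
      rw [hx]
      linear_combination (-y' x * Complex.exp ((k * x : ℝ) * Complex.I) *
        Complex.exp ((-k * x : ℝ) * Complex.I)) * Complex.I_mul_I + y' x * hexp x
  · refine shiftedMomentum_of_primitive (ψ := fun x => -Complex.I * y' x)
      (ψ' := fun x => -Complex.I * ((V x - μ) • y x)) (by fun_prop)
      (((hqi 0 p).smul_continuousOn hyc.continuousOn).const_mul _) (fun x hx => ?_)
      (by rw [h2]; ring) ?_ ?_
    · rw [intervalIntegral.integral_const_mul, hy.deriv_eq x hx]; ring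
    · filter_upwards [e2] with x hx
      rw [hx]
      linear_combination (-Complex.I * y' x) * hexp x
    · filter_upwards [e3] with x hx
      rw [hx, Complex.real_smul, Complex.real_smul]
      linear_combination (-Complex.I * (V x - μ : ℝ) * y x) * hexp x
  · filter_upwards [coeFn_toL2 m1, coeFn_toL2 m3, Lp.coeFn_smul (μ : ℂ) (toL2 _ m1)]
      with t a1 a3 a4
    rw [a4, Pi.smul_apply, a1, a3]
    obtain ⟨x, hx, rfl⟩ := AddCircle.eq_coe_Ioc t
    rw [AddCircle.liftIoc_zero_coe_apply hx, AddCircle.liftIoc_zero_coe_apply hx,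
      Function.Periodic.lift_coe, Complex.real_smul, smul_eq_mul]
    push_cast
    ring

/-! ### The fiber operator as a linear operator -/

theorem IsWeakDeriv.add {u v u' v' : L2 p} (h : IsWeakDeriv p u v) (h' : IsWeakDeriv p u' v') :
    IsWeakDeriv p (u + u') (v + v') := by
  intro φ hφ hper
  have hφ0 : Continuous φ := hφ.continuous
  have hφc : Continuous (deriv φ) := hφ.continuous_deriv (by simp)
  have e : ∀ (a b : L2 p) (f : ℝ → ℂ), Continuous f →
      ∫ x in (0 : ℝ)..p, (a + b : L2 p) (x : AddCircle p) * f x =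
        (∫ x in (0 : ℝ)..p, a (x : AddCircle p) * f x) +
          ∫ x in (0 : ℝ)..p, b (x : AddCircle p) * f x := by
    intro a b f hf
    rw [← intervalIntegral.integral_add
      ((intervalIntegrable_L2 _ _ _).mul_continuousOn hf.continuousOn)
      ((intervalIntegrable_L2 _ _ _).mul_continuousOn hf.continuousOn)]
    refine integral_congr_Ioc (right_mem_Icc.2 hp.out.le) ?_
    filter_upwards [ae_Ioc_of_ae (Lp.coeFn_add a b)] with x hx
    rw [hx, Pi.add_apply, add_mul]
  rw [e _ _ _ hφc, e _ _ _ hφ0, h φ hφ hper, h' φ hφ hper]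
  ring

theorem IsWeakDeriv.smul {u v : L2 p} (h : IsWeakDeriv p u v) (c : ℂ) :
    IsWeakDeriv p (c • u) (c • v) := by
  intro φ hφ hper
  have e : ∀ (a : L2 p) (f : ℝ → ℂ),
      ∫ x in (0 : ℝ)..p, (c • a : L2 p) (x : AddCircle p) * f x =
        c * ∫ x in (0 : ℝ)..p, a (x : AddCircle p) * f x := by
    intro a f
    rw [← intervalIntegral.integral_const_mul]
    refine integral_congr_Ioc (right_mem_Icc.2 hp.out.le) ?_
    filter_upwards [ae_Ioc_of_ae (Lp.coeFn_smul c a)] with x hx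
    rw [hx, Pi.smul_apply, smul_eq_mul, mul_assoc]
  rw [e, e, h φ hφ hper]
  ring

theorem ShiftedMomentum.add {k : ℝ} {u g u' g' : L2 p} (h : ShiftedMomentum p k u g)
    (h' : ShiftedMomentum p k u' g') : ShiftedMomentum p k (u + u') (g + g') := by
  obtain ⟨v, hv, rfl⟩ := h
  obtain ⟨v', hv', rfl⟩ := h'
  exact ⟨_, hv.add hv', by simp only [smul_add]; abel⟩

theorem ShiftedMomentum.smul {k : ℝ} {u g : L2 p} (h : ShiftedMomentum p k u g) (c : ℂ) :
    ShiftedMomentum p k (c • u) (c • g) := by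
  obtain ⟨v, hv, rfl⟩ := h
  exact ⟨_, hv.smul c, by simp only [smul_add, smul_comm c]⟩

theorem ShiftedMomentum.eq_zero {k : ℝ} {g : L2 p} (h : ShiftedMomentum p k 0 g) : g = 0 := by
  obtain ⟨v, hv, rfl⟩ := h
  rw [hv.eq_zero]; simp

theorem FiberOperator.add {V : AddCircle p → ℝ} {k : ℝ} {u f u' f' : L2 p}
    (h : FiberOperator p V k u f) (h' : FiberOperator p V k u' f') :
    FiberOperator p V k (u + u') (f + f') := by
  obtain ⟨g, w, h1, h2, h3⟩ := h
  obtain ⟨g', w', h1', h2', h3'⟩ := h'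
  refine ⟨_, _, h1.add h1', h2.add h2', ?_⟩
  filter_upwards [h3, h3', Lp.coeFn_add f f', Lp.coeFn_add w w', Lp.coeFn_add u u']
    with t a1 a2 a3 a4 a5
  rw [a3, a4, a5, Pi.add_apply, Pi.add_apply, Pi.add_apply, a1, a2]
  ring

theorem FiberOperator.smul {V : AddCircle p → ℝ} {k : ℝ} {u f : L2 p}
    (h : FiberOperator p V k u f) (c : ℂ) : FiberOperator p V k (c • u) (c • f) := by
  obtain ⟨g, w, h1, h2, h3⟩ := h
  refine ⟨_, _, h1.smul c, h2.smul c, ?_⟩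
  filter_upwards [h3, Lp.coeFn_smul c f, Lp.coeFn_smul c w, Lp.coeFn_smul c u] with t a1 a2 a3 a4
  rw [a2, a3, a4, Pi.smul_apply, Pi.smul_apply, Pi.smul_apply, a1]
  simp only [smul_eq_mul]
  ring

theorem FiberOperator.zero {V : AddCircle p → ℝ} {k : ℝ} : FiberOperator p V k 0 0 := by
  refine ⟨0, 0, ⟨0, isWeakDeriv_zero, by simp⟩, ⟨0, isWeakDeriv_zero, by simp⟩, ?_⟩
  filter_upwards [Lp.coeFn_zero ℂ 2 (volume : Measure (AddCircle p))] with t ht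
  rw [ht]; simp

theorem FiberOperator.eq_zero {V : AddCircle p → ℝ} {k : ℝ} {f : L2 p}
    (h : FiberOperator p V k 0 f) : f = 0 := by
  obtain ⟨g, w, h1, h2, h3⟩ := h
  rw [h1.eq_zero] at h2
  rw [h2.eq_zero] at h3
  rw [Lp.eq_zero_iff_ae_eq_zero]
  filter_upwards [h3, Lp.coeFn_zero ℂ 2 (volume : Measure (AddCircle p))] with t a1 a2
  rw [a1, a2]; simp

/-- Eigenvectors for distinct eigenvalues are linearly independent: the graph of the fiber operator
extends to a linear map defined everywhere. -/
theorem linearIndependent_of_eigenvalues {V : AddCircle p → ℝ} {k : ℝ} {ι : Type*} {μ : ι → ℝ}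
    (hμ : Function.Injective μ) {u : ι → L2 p} (hu : ∀ i, u i ≠ 0)
    (h : ∀ i, FiberOperator p V k (u i) ((μ i : ℂ) • u i)) : LinearIndependent ℂ u := by
  let G : Submodule ℂ (L2 p × L2 p) :=
    { carrier := {x | FiberOperator p V k x.1 x.2}
      add_mem' := fun ha hb => FiberOperator.add ha hb
      zero_mem' := FiberOperator.zero
      smul_mem' := fun c _ ha => FiberOperator.smul ha c }
  have hG : ∀ x ∈ G, x.1 = 0 → x.2 = 0 := by
    rintro ⟨a, b⟩ hx (rfl : a = 0)
    exact FiberOperator.eq_zero hx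
  obtain ⟨T, hT⟩ := LinearMap.exists_extend G.toLinearPMap.toFun
  have hTu : ∀ i, T (u i) = (μ i : ℂ) • u i := by
    intro i
    have hmem : (u i, (μ i : ℂ) • u i) ∈ G.toLinearPMap.graph := by
      rw [Submodule.toLinearPMap_graph_eq G hG]
      exact h i
    obtain ⟨x, hx1, hx2⟩ := (LinearPMap.mem_graph_iff _).1 hmem
    have := LinearMap.congr_fun hT x
    simp only at hx1 hx2
    rw [← hx2, ← hx1]
    exact this
  exact Module.End.eigenvectors_linearIndependent' T (fun i => (μ i : ℂ))
    (fun i j hij => hμ (Complex.ofReal_injective hij)) u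
    fun i => Module.End.hasEigenvector_iff.2 ⟨Module.End.mem_eigenspace_iff.2 (hTu i), hu i⟩

end Circle

/-! ### Band energies and the discriminant -/

section Bands

variable {p : ℝ}

theorem cos_mul_eq_cos_abs_mul {k : ℝ} (hp0 : 0 < p) : Real.cos (k * p) = Real.cos (|k| * p) := by
  rw [← Real.cos_abs (k * p), abs_mul, abs_of_pos hp0]

variable [hp : Fact (0 < p)] {V : ℝ → ℝ} {R : ℝ}

theorem eq_zero_of_ae_Ioc {u : L2 p}
    (h : ∀ᵐ x : ℝ ∂volume.restrict (Ioc 0 p), u (x : AddCircle p) = 0) : u = 0 := by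
  rw [Lp.eq_zero_iff_ae_eq_zero]
  have hmp := AddCircle.measurePreserving_mk p 0
  rw [zero_add] at hmp
  have hms : MeasurableSet {t : AddCircle p | u t = 0} :=
    (Lp.stronglyMeasurable u).measurable (measurableSet_singleton 0)
  have := (ae_map_iff hmp.measurable.aemeasurable hms).2 h
  rwa [hmp.map_eq] at this

theorem eq_zero_of_ae_gauge {k : ℝ} {u : L2 p}
    (h : ∀ᵐ x : ℝ ∂volume.restrict (Ioc 0 p),
      Complex.exp ((k * x : ℝ) * Complex.I) * u (x : AddCircle p) = 0) : u = 0 :=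
  eq_zero_of_ae_Ioc (h.mono fun _ hx => (mul_eq_zero.1 hx).resolve_left (Complex.exp_ne_zero _))

/-- A nonzero eigenfunction yields a quasi-periodic solution with nonzero initial data. -/
theorem FiberOperator.exists_solution_ne_zero (F : FundamentalSystem p V)
    (hVp : Function.Periodic V p) (hV : BoundedPotential V R) {k μ : ℝ} {u : L2 p}
    (h : FiberOperator p hVp.lift k u ((μ : ℂ) • u)) (hu : u ≠ 0) :
    ∃ y y' : ℝ → ℂ, IsSolution p (fun x => V x - μ) y y' ∧
      y p = Complex.exp ((k * p : ℝ) * Complex.I) * y 0 ∧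
      y' p = Complex.exp ((k * p : ℝ) * Complex.I) * y' 0 ∧ (y 0 ≠ 0 ∨ y' 0 ≠ 0) ∧
      ∀ᵐ x : ℝ ∂volume.restrict (Ioc 0 p),
        Complex.exp ((k * x : ℝ) * Complex.I) * u (x : AddCircle p) = y x := by
  obtain ⟨y, y', hy, h1, h2, h3⟩ := h.exists_solution hVp
  refine ⟨y, y', hy, h1, h2, ?_, h3⟩
  by_contra! h0
  refine hu (eq_zero_of_ae_gauge (k := k) ?_)
  filter_upwards [h3, ae_restrict_mem measurableSet_Ioc] with x hx hx'
  rw [hx, (F.eq_of_isSolution hV hy ⟨hx'.1.le, hx'.2⟩).1, h0.1, h0.2]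
  simp

theorem FiberOperator.disc_eq (F : FundamentalSystem p V) (hVp : Function.Periodic V p)
    (hV : BoundedPotential V R) {k μ : ℝ} {u : L2 p}
    (h : FiberOperator p hVp.lift k u ((μ : ℂ) • u)) (hu : u ≠ 0) :
    F.disc μ = 2 * Real.cos (k * p) := by
  obtain ⟨y, y', hy, h1, h2, h0, -⟩ := h.exists_solution_ne_zero F hVp hV hu
  exact F.disc_eq_of_quasiperiodic hp.out.le hV hy h1 h2 h0

theorem exists_eigenvector (F : FundamentalSystem p V) (hVp : Function.Periodic V p)
    (hV : BoundedPotential V R) {k μ : ℝ} (h : F.disc μ = 2 * Real.cos (k * p)) :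
    ∃ u : L2 p, u ≠ 0 ∧ FiberOperator p hVp.lift k u ((μ : ℂ) • u) := by
  obtain ⟨y, y', hy, h1, h2, h0⟩ := F.exists_quasiperiodic hp.out.le hV h
  obtain ⟨u, hu, huy⟩ := exists_fiberOperator_of_solution hVp hV hy h1 h2
  refine ⟨u, ?_, hu⟩
  rintro rfl
  have hz : ∀ᵐ x ∂volume.restrict (Ioo 0 p), y x = 0 := by
    refine ae_restrict_of_ae_restrict_of_subset Ioo_subset_Ioc_self ?_
    filter_upwards [huy, coeFn_zero_ae (p := p)] with x hx hx'
    rw [← hx, hx', mul_zero]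
  have hz' : EqOn y (fun _ => 0) (Ioo 0 p) :=
    Measure.eqOn_open_of_ae_eq hz isOpen_Ioo hy.continuous.continuousOn continuousOn_const
  have := hy.deriv_zero_of_eq_zero hp.out hz'
  rcases h0 with h | h
  · exact h this.1
  · exact h this.2

/-- If the multiplier `e^{ikp}` is not real, the eigenvalues are simple. -/
theorem not_linearIndependent_of_same_eigenvalue (F : FundamentalSystem p V)
    (hVp : Function.Periodic V p) (hV : BoundedPotential V R) {k μ : ℝ}
    (hk : Real.sin (k * p) ≠ 0) {u w : L2 p}
    (hu : FiberOperator p hVp.lift k u ((μ : ℂ) • u))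
    (hw : FiberOperator p hVp.lift k w ((μ : ℂ) • w)) : ¬ LinearIndependent ℂ ![u, w] := by
  intro hli
  have hu0 : u ≠ 0 := hli.ne_zero 0
  have hw0 : w ≠ 0 := hli.ne_zero 1
  obtain ⟨y, y', hy, hy1, hy2, hy0, hyu⟩ := hu.exists_solution_ne_zero F hVp hV hu0
  obtain ⟨z, z', hz, hz1, hz2, hz0, hzw⟩ := hw.exists_solution_ne_zero F hVp hV hw0
  have hprop := F.quasiperiodic_proportional hp.out.le hV hk hy hy1 hz hz1
  have hne := F.deriv_zero_ne_zero_of_quasiperiodic hp.out.le hV hk hz hz1 hz0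
  refine hne (LinearIndependent.pair_iff.1 hli (z' 0) (-y' 0) ?_).1
  refine eq_zero_of_ae_gauge (k := k) ?_
  filter_upwards [hyu, hzw, ae_restrict_mem measurableSet_Ioc,
    ae_Ioc_of_ae (Lp.coeFn_add (z' 0 • u) (-y' 0 • w)), ae_Ioc_of_ae (Lp.coeFn_smul (z' 0) u),
    ae_Ioc_of_ae (Lp.coeFn_smul (-y' 0) w)] with x a1 a2 a3 a4 a5 a6
  have := hprop x ⟨a3.1.le, a3.2⟩
  rw [a4, Pi.add_apply, a5, a6, Pi.smul_apply, Pi.smul_apply, smul_eq_mul, smul_eq_mul]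
  linear_combination (z' 0) * a1 - (y' 0) * a2 + this

/-- The energies `E` for which `H(k)` has `n + 1` independent eigenvectors with eigenvalues at most
`E`. Its infimum is `bandEnergy`. -/
def bandSet (p : ℝ) [Fact (0 < p)] (V : AddCircle p → ℝ) (n : ℕ) (k : ℝ) : Set ℝ :=
  {E : ℝ | ∃ u : Fin (n + 1) → L2 p, LinearIndependent ℂ u ∧
    ∀ i, ∃ μ : ℝ, μ ≤ E ∧ FiberOperator p V k (u i) ((μ : ℂ) • u i)}

theorem mem_bandSet_of_injective (F : FundamentalSystem p V) (hVp : Function.Periodic V p)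
    (hV : BoundedPotential V R) {k E : ℝ} {n : ℕ} {μ : Fin (n + 1) → ℝ}
    (hμ : Function.Injective μ) (h : ∀ i, F.disc (μ i) = 2 * Real.cos (k * p))
    (hE : ∀ i, μ i ≤ E) : E ∈ bandSet p hVp.lift n k := by
  choose u hu0 hu using fun i => exists_eigenvector F hVp hV (h i)
  exact ⟨u, linearIndependent_of_eigenvalues hμ hu0 hu, fun i => ⟨μ i, hE i, hu i⟩⟩

theorem exists_eigenvalue_mem_bandSet (F : FundamentalSystem p V) (hVp : Function.Periodic V p)
    (hV : BoundedPotential V R) {k E : ℝ} {n : ℕ} (hE : E ∈ bandSet p hVp.lift n k) :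
    ∃ μ ≤ E, F.disc μ = 2 * Real.cos (k * p) ∧ μ ∈ bandSet p hVp.lift n k := by
  obtain ⟨u, hli, hu⟩ := hE
  choose μ hμE hμ using hu
  obtain ⟨j, -, hj⟩ := Finset.exists_max_image Finset.univ μ Finset.univ_nonempty
  exact ⟨μ j, hμE j, (hμ j).disc_eq F hVp hV (hli.ne_zero j), u, hli,
    fun i => ⟨μ i, hj i (Finset.mem_univ i), hμ i⟩⟩

theorem bandSet_nonempty (F : FundamentalSystem p V) (hVp : Function.Periodic V p)
    (hV : BoundedPotential V R) (n : ℕ) (k : ℝ) : (bandSet p hVp.lift n k).Nonempty := by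
  have hv : |2 * Real.cos (k * p)| ≤ 2 := by
    rw [abs_mul, abs_two]; linarith [Real.abs_cos_le_one (k * p)]
  have hinf : {E | F.disc E = 2 * Real.cos (k * p)}.Infinite := by
    refine infinite_of_not_bddAbove fun ⟨B, hB⟩ => ?_
    obtain ⟨E, hE, hE'⟩ := F.exists_disc_eq hp.out hV hv B
    exact not_lt.2 (hB hE') hE
  have e := hinf.natEmbedding
  set μ : Fin (n + 1) → ℝ := fun i => e i with hμ
  obtain ⟨j, -, hj⟩ := Finset.exists_max_image Finset.univ μ Finset.univ_nonempty
  refine ⟨μ j, mem_bandSet_of_injective F hVp hV (μ := μ) (fun a b hab => ?_)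
    (fun i => (e i).2) fun i => hj i (Finset.mem_univ i)⟩
  exact Fin.val_injective (e.injective (Subtype.ext hab))

theorem bddBelow_bandSet (F : FundamentalSystem p V) (hVp : Function.Periodic V p)
    (hV : BoundedPotential V R) (n : ℕ) (k : ℝ) : BddBelow (bandSet p hVp.lift n k) := by
  refine ⟨-R, fun E hE => ?_⟩
  obtain ⟨μ, hμE, hμ, -⟩ := exists_eigenvalue_mem_bandSet F hVp hV hE
  refine (F.neg_le_of_abs_disc_le hp.out hV ?_).trans hμE
  rw [hμ, abs_mul, abs_two]; linarith [Real.abs_cos_le_one (k * p)]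

/-- Every band energy is an eigenvalue: the infimum is a limit of eigenvalues, which form a closed
set as the level set of the discriminant. -/
theorem disc_bandEnergy (F : FundamentalSystem p V) (hVp : Function.Periodic V p)
    (hV : BoundedPotential V R) (n : ℕ) (k : ℝ) :
    F.disc (bandEnergy p hVp.lift n k) = 2 * Real.cos (k * p) := by
  have hcl : IsClosed {E | F.disc E = 2 * Real.cos (k * p)} :=
    isClosed_eq (F.continuous_disc hp.out.le hV) continuous_const
  have hbd := bddBelow_bandSet F hVp hV n k
  refine hcl.closure_subset (Metric.mem_closure_iff.2 fun ε hε => ?_)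
  obtain ⟨E, hE, hlt⟩ := Real.lt_sInf_add_pos (bandSet_nonempty F hVp hV n k) hε
  obtain ⟨μ, hμE, hμ, hμS⟩ := exists_eigenvalue_mem_bandSet F hVp hV hE
  have h1 : bandEnergy p hVp.lift n k ≤ μ := csInf_le hbd hμS
  have h2 : bandEnergy p hVp.lift n k + ε > E := hlt
  refine ⟨μ, hμ, ?_⟩
  rw [Real.dist_eq, abs_lt]
  constructor <;> linarith

theorem sin_ne_zero_of_abs_cos_lt {θ : ℝ} (h : |2 * Real.cos θ| < 2) : Real.sin θ ≠ 0 := by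
  intro h0
  have h1 := Real.sin_sq_add_cos_sq θ
  rw [h0] at h1
  rw [abs_lt] at h
  nlinarith

theorem abs_cos_lt_of_sin_ne_zero {θ : ℝ} (h : Real.sin θ ≠ 0) : |2 * Real.cos θ| < 2 := by
  have h1 := Real.sin_sq_add_cos_sq θ
  have h2 : 0 < Real.sin θ ^ 2 := by positivity
  rw [abs_lt]
  constructor <;> nlinarith

/-- For `k` with nonreal multiplier `e^{ikp}`, the band energies are the points of the level set
`Δ = 2 cos (kp)` in increasing order. -/
theorem bandEnergy_eq_of_rank (F : FundamentalSystem p V) (hVp : Function.Periodic V p)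
    (hV : BoundedPotential V R) {k e : ℝ} {n : ℕ} (hk : |2 * Real.cos (k * p)| < 2)
    (he : F.disc e = 2 * Real.cos (k * p))
    (hn : (levelBelow F.disc (2 * Real.cos (k * p)) e).ncard = n) :
    bandEnergy p hVp.lift n k = e := by
  have hfin := (F.isDiscriminant hp.out hV).finite_levelBelow hk e
  refine IsLeast.csInf_eq (s := bandSet p hVp.lift n k) ⟨?_, fun E hE => ?_⟩
  · have hfin' := hfin.insert e
    have hcard : hfin'.toFinset.card = n + 1 := by
      rw [← ncard_eq_toFinset_card _ hfin', ncard_insert_of_notMem (fun h => lt_irrefl _ h.1) hfin,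
        hn]
    have eqv := (Finset.equivFinOfCardEq hcard).symm
    have hmem : ∀ i, (eqv i : ℝ) ∈ insert e (levelBelow F.disc (2 * Real.cos (k * p)) e) :=
      fun i => hfin'.mem_toFinset.1 (eqv i).2
    refine mem_bandSet_of_injective F hVp hV (μ := fun i => eqv i)
      (Subtype.val_injective.comp eqv.injective) (fun i => ?_) fun i => ?_
    · rcases hmem i with h | h
      · simp only [h, he]
      · exact h.2
    · rcases hmem i with h | h
      · exact h.le
      · exact h.1.le
  · obtain ⟨u, hli, hu⟩ := hE
    choose μ hμE hμ using hu
    have hinj : Function.Injective μ := by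
      intro i j hij
      by_contra hne
      have h1 := hμ j
      rw [← hij] at h1
      refine not_linearIndependent_of_same_eigenvalue F hVp hV (sin_ne_zero_of_abs_cos_lt hk)
        (hμ i) h1 ?_
      have h2 := hli.comp ![i, j] (by
        intro a b hab
        fin_cases a <;> fin_cases b <;> simp_all)
      convert! h2 using 1
      ext a
      fin_cases a <;> rfl
    by_contra! hlt
    have hsub : range μ ⊆ levelBelow F.disc (2 * Real.cos (k * p)) e := by
      rintro _ ⟨i, rfl⟩
      exact ⟨(hμE i).trans_lt hlt, (hμ i).disc_eq F hVp hV (hli.ne_zero i)⟩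
    have h1 := ncard_le_ncard hsub hfin
    rw [hn, ← image_univ, ncard_image_of_injective _ hinj, ncard_univ, Nat.card_eq_fintype_card,
      Fintype.card_fin] at h1
    omega

theorem ncard_levelBelow_bandEnergy (F : FundamentalSystem p V) (hVp : Function.Periodic V p)
    (hV : BoundedPotential V R) {k : ℝ} (n : ℕ) (hk : |2 * Real.cos (k * p)| < 2) :
    (levelBelow F.disc (2 * Real.cos (k * p)) (bandEnergy p hVp.lift n k)).ncard = n := by
  obtain ⟨e, he, hn⟩ := (F.isDiscriminant hp.out hV).exists_ncard_levelBelow_eq hk n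
  rwa [bandEnergy_eq_of_rank F hVp hV hk he hn]

theorem neg_le_bandEnergy (F : FundamentalSystem p V) (hVp : Function.Periodic V p)
    (hV : BoundedPotential V R) (n : ℕ) (k : ℝ) : -R ≤ bandEnergy p hVp.lift n k := by
  refine F.neg_le_of_abs_disc_le hp.out hV ?_
  rw [disc_bandEnergy F hVp hV, abs_mul, abs_two]
  linarith [Real.abs_cos_le_one (k * p)]

/-- Implicit differentiation of `Δ(E(k)) = 2 cos (kp)`. -/
theorem hasDerivAt_bandEnergy (F : FundamentalSystem p V) (hVp : Function.Periodic V p)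
    (hV : BoundedPotential V R) {k : ℝ} (n : ℕ) (hk : |2 * Real.cos (k * p)| < 2) :
    HasDerivAt (bandEnergy p hVp.lift n)
      ((-∫ t in 0..p, F.monodromyForm (bandEnergy p hVp.lift n k) t)⁻¹ *
        (-(2 * p * Real.sin (k * p)))) k := by
  have hf := F.isDiscriminant hp.out hV
  have hex : ∀ v, ∃ e, |v| < 2 → F.disc e = v ∧ (levelBelow F.disc v e).ncard = n := by
    intro v
    by_cases hv : |v| < 2
    · obtain ⟨e, he⟩ := hf.exists_ncard_levelBelow_eq hv n
      exact ⟨e, fun _ => he⟩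
    · exact ⟨0, fun h => absurd h hv⟩
  choose G hG using hex
  have hEG : ∀ k, |2 * Real.cos (k * p)| < 2 →
      bandEnergy p hVp.lift n k = G (2 * Real.cos (k * p)) := fun k hk =>
    bandEnergy_eq_of_rank F hVp hV hk (hG _ hk).1 (hG _ hk).2
  have h1 := hf.hasDerivAt_of_rank hG hk
  have h2 : HasDerivAt (fun k => 2 * Real.cos (k * p)) (-(2 * p * Real.sin (k * p))) k := by
    have := (((hasDerivAt_id k).mul_const p).cos).const_mul 2
    convert! this using 1
    simp; ring
  have hnear : ∀ᶠ k' in nhds k, |2 * Real.cos (k' * p)| < 2 := by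
    have hc : Continuous fun k' : ℝ => |2 * Real.cos (k' * p)| := by fun_prop
    exact hc.continuousAt.eventually_lt_const hk
  rw [hEG k hk]
  exact (h1.comp k h2).congr_of_eventuallyEq (hnear.mono fun k' hk' => hEG k' hk')

/-! ### Quantitative estimates -/

theorem FundamentalSystem.abs_deriv_disc_le (F : FundamentalSystem p V)
    (hV : BoundedPotential V R) {E : ℝ} (hE : -R ≤ E) :
    |-∫ t in 0..p, F.monodromyForm E t| ≤ 4 * p ^ 2 * Real.exp (9 * √R * p) := by
  have h := (F.hasDerivAt_disc hp.out.le hV E).hasDerivWithinAt (s := Ioi E)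
  rw [hasDerivWithinAt_iff_tendsto_slope' self_notMem_Ioi] at h
  refine le_of_tendsto h.abs ?_
  filter_upwards [self_mem_nhdsWithin] with E' hE'
  have hE' : E < E' := hE'
  have h0 : 0 < |E' - E| := abs_pos.2 (sub_pos.2 hE').ne'
  rw [slope_def_field, abs_div, div_le_iff₀ h0]
  exact F.abs_disc_sub_le hp.out.le hV hE (hE.trans hE'.le)

theorem sq_sub_le_abs_cos_sub {a b : ℝ} (ha : a ∈ Icc 0 Real.pi) (hb : b ∈ Icc 0 Real.pi) :
    4 / Real.pi ^ 2 * (a - b) ^ 2 ≤ |2 * Real.cos a - 2 * Real.cos b| := by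
  wlog hab : b ≤ a generalizing a b
  · have := this hb ha (le_of_not_ge hab)
    rw [abs_sub_comm, ← neg_sub b a, neg_sq]
    exact this
  have hpi := Real.pi_pos
  have h1 : 2 / Real.pi * ((a - b) / 2) ≤ Real.sin ((a - b) / 2) :=
    Real.mul_le_sin (by linarith) (by linarith [ha.2, hb.1])
  have h0 : 0 ≤ 2 / Real.pi * ((a - b) / 2) := by
    have : 0 ≤ a - b := by linarith
    positivity
  have h2 : Real.sin ((a - b) / 2) ≤ Real.sin ((a + b) / 2) := by
    rcases le_total ((a + b) / 2) (Real.pi / 2) with h | h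
    · exact Real.sin_le_sin_of_le_of_le_pi_div_two (by linarith) h (by linarith [hb.1])
    · rw [← Real.sin_pi_sub ((a + b) / 2)]
      exact Real.sin_le_sin_of_le_of_le_pi_div_two (by linarith) (by linarith)
        (by linarith [ha.2])
  have h3 : 2 * Real.cos a - 2 * Real.cos b =
      -(4 * (Real.sin ((a + b) / 2) * Real.sin ((a - b) / 2))) := by
    rw [← mul_sub, Real.cos_sub_cos]; ring
  rw [h3, abs_neg, abs_of_nonneg (by
    have := h0.trans h1
    have := this.trans h2
    positivity)]
  have h4 : (2 / Real.pi * ((a - b) / 2)) * (2 / Real.pi * ((a - b) / 2)) ≤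
      Real.sin ((a + b) / 2) * Real.sin ((a - b) / 2) :=
    mul_le_mul (h1.trans h2) h1 h0 ((h0.trans h1).trans h2)
  calc 4 / Real.pi ^ 2 * (a - b) ^ 2
      = 4 * ((2 / Real.pi * ((a - b) / 2)) * (2 / Real.pi * ((a - b) / 2))) := by
        field_simp
    _ ≤ _ := by gcongr

theorem abs_mul_mem_Icc {k : ℝ} (hk : k ∈ brillouinZone p) : |k| * p ∈ Icc 0 Real.pi := by
  have hp0 := hp.out
  have hkk : |k| ≤ Real.pi / p := abs_le.2 ⟨hk.1.le, hk.2⟩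
  exact ⟨by positivity, (le_div_iff₀ hp0).1 hkk⟩

theorem sin_ne_zero_of_mem_brillouinZone {k : ℝ} (hk : k ∈ brillouinZone p) (h0 : k ≠ 0)
    (h1 : k ≠ Real.pi / p) : Real.sin (k * p) ≠ 0 := by
  have hp0 := hp.out
  have hk1 : -Real.pi < k * p := by
    have := hk.1
    rw [← neg_div, div_lt_iff₀ hp0] at this
    exact this
  have hk2 : k * p < Real.pi := (lt_div_iff₀ hp0).1 (lt_of_le_of_ne hk.2 h1)
  rw [Ne, Real.sin_eq_zero_iff_of_lt_of_lt hk1 hk2]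
  exact mul_ne_zero h0 hp0.ne'

theorem deriv_bandEnergy_lower_bound (F : FundamentalSystem p V) (hVp : Function.Periodic V p)
    (hV : BoundedPotential V R) {k : ℝ} (n : ℕ) (hk : |2 * Real.cos (k * p)| < 2) :
    2 * |Real.sin (p * k)| / (5 * p) * Real.exp (-2 * 5 * √R * p) ≤
      |deriv (bandEnergy p hVp.lift n) k| := by
  have hp0 := hp.out
  have hE := neg_le_bandEnergy F hVp hV n k
  set E := bandEnergy p hVp.lift n k with hEdef
  have hne : -∫ t in 0..p, F.monodromyForm E t ≠ 0 :=
    F.deriv_disc_ne_zero hp0 hV (by rw [hEdef, disc_bandEnergy F hVp hV]; exact hk)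
  have hle := F.abs_deriv_disc_le hV hE
  rw [(hasDerivAt_bandEnergy F hVp hV n hk).deriv, ← hEdef]
  set d := -∫ t in 0..p, F.monodromyForm E t
  have hd : 0 < |d| := abs_pos.2 hne
  rw [abs_mul, abs_inv, abs_neg (2 * p * _), abs_mul, abs_of_pos (by positivity : 0 < 2 * p), mul_comm k p,
    inv_mul_eq_div]
  have hexp : Real.exp (-2 * 5 * √R * p) ≤ Real.exp (-(9 * √R * p)) := by
    refine Real.exp_le_exp.2 ?_
    have : 0 ≤ √R * p := by positivity
    linarith
  have hexp' : Real.exp (-(9 * √R * p)) * Real.exp (9 * √R * p) = 1 := by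
    rw [← Real.exp_add]; simp
  rw [le_div_iff₀ hd]
  calc 2 * |Real.sin (p * k)| / (5 * p) * Real.exp (-2 * 5 * √R * p) * |d|
      ≤ 2 * |Real.sin (p * k)| / (5 * p) * Real.exp (-(9 * √R * p)) *
          (4 * p ^ 2 * Real.exp (9 * √R * p)) := by gcongr
    _ = 4 / 5 * (2 * p * |Real.sin (p * k)|) *
          (Real.exp (-(9 * √R * p)) * Real.exp (9 * √R * p)) := by field_simp
    _ ≤ 2 * p * |Real.sin (p * k)| := by
        rw [hexp', mul_one]
        have : 0 ≤ 2 * p * |Real.sin (p * k)| := by positivity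
        linarith

/-- Two energies at which the discriminant differs by `2 cos a - 2 cos b` are far apart. -/
theorem FundamentalSystem.sq_sub_le_of_disc (F : FundamentalSystem p V)
    (hV : BoundedPotential V R) {E E' κ κ' : ℝ} (hE : -R ≤ E) (hE' : -R ≤ E')
    (hκ : κ * p ∈ Icc 0 Real.pi) (hκ' : κ' * p ∈ Icc 0 Real.pi)
    (h : |2 * Real.cos (κ' * p) - 2 * Real.cos (κ * p)| ≤ |F.disc E' - F.disc E|) :
    (κ' - κ) ^ 2 ≤ Real.pi ^ 2 * Real.exp (9 * √R * p) * |E' - E| := by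
  have hp0 := hp.out
  have h1 := ((sq_sub_le_abs_cos_sub hκ' hκ).trans h).trans
    (F.abs_disc_sub_le hp0.le hV hE hE')
  have h2 : 4 / Real.pi ^ 2 * (κ' * p - κ * p) ^ 2 =
      4 * p ^ 2 / Real.pi ^ 2 * (κ' - κ) ^ 2 := by ring
  have h3 : 4 * p ^ 2 * Real.exp (9 * √R * p) * |E' - E| = 4 * p ^ 2 / Real.pi ^ 2 *
      (Real.pi ^ 2 * Real.exp (9 * √R * p) * |E' - E|) := by
    field_simp
  rw [h2, h3] at h1
  exact le_of_mul_le_mul_left h1 (by positivity)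

theorem bandEnergy_sub_lower_bound (F : FundamentalSystem p V) (hVp : Function.Periodic V p)
    (hV : BoundedPotential V R) (n : ℕ) {k₁ k₂ : ℝ} (hk₁ : k₁ ∈ brillouinZone p)
    (hk₂ : k₂ ∈ brillouinZone p) :
    Real.exp (-2 * 5 * √R * p) / (Real.pi * 5) * (|k₂| - |k₁|) ^ 2 ≤
      |bandEnergy p hVp.lift n k₂ - bandEnergy p hVp.lift n k₁| := by
  have hp0 := hp.out
  have h := F.sq_sub_le_of_disc hV (neg_le_bandEnergy F hVp hV n k₁)
    (neg_le_bandEnergy F hVp hV n k₂) (abs_mul_mem_Icc hk₁) (abs_mul_mem_Icc hk₂) (by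
      rw [disc_bandEnergy F hVp hV, disc_bandEnergy F hVp hV, ← cos_mul_eq_cos_abs_mul hp0,
        ← cos_mul_eq_cos_abs_mul hp0])
  set d := |bandEnergy p hVp.lift n k₂ - bandEnergy p hVp.lift n k₁|
  have hd : 0 ≤ d := abs_nonneg _
  have hexp : Real.exp (-2 * 5 * √R * p) ≤ Real.exp (-(9 * √R * p)) := by
    refine Real.exp_le_exp.2 ?_
    have : 0 ≤ √R * p := by positivity
    linarith
  have hexp' : Real.exp (-(9 * √R * p)) * Real.exp (9 * √R * p) = 1 := by
    rw [← Real.exp_add]; simp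
  calc _ ≤ Real.exp (-(9 * √R * p)) / (Real.pi * 5) *
        (Real.pi ^ 2 * Real.exp (9 * √R * p) * d) := by gcongr
    _ = Real.pi / 5 * d * (Real.exp (-(9 * √R * p)) * Real.exp (9 * √R * p)) := by
        field_simp
    _ ≤ d := by
        rw [hexp', mul_one]
        nlinarith [Real.pi_le_four]

/-- If two bands come within `ε` of each other at `k`, then `k` is close to `0` or `±π/p`, because
the discriminant leaves `(-2, 2)` between the two energies. -/
theorem close_of_mem_closeBands (F : FundamentalSystem p V) (hVp : Function.Periodic V p)
    (hV : BoundedPotential V R) {k ε : ℝ} (hε : 0 ≤ ε) (hk : k ∈ closeBands p hVp.lift ε) :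
    |k| ≤ √(5 * Real.pi) * Real.exp (5 * √R * p) * √ε ∨
      Real.pi / p - |k| ≤ √(5 * Real.pi) * Real.exp (5 * √R * p) * √ε := by
  have hp0 := hp.out
  set L := √(5 * Real.pi) * Real.exp (5 * √R * p) * √ε with hL
  have hL0 : 0 ≤ L := by positivity
  have hpi := Real.pi_pos
  obtain ⟨hkB, n, m, hnm, hle⟩ := hk
  rcases eq_or_ne k 0 with h0 | h0
  · left; rw [h0, abs_zero]; exact hL0
  rcases eq_or_ne k (Real.pi / p) with h1 | h1
  · right; rw [h1, abs_of_pos (by positivity), sub_self]; exact hL0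
  have hcos := abs_cos_lt_of_sin_ne_zero (sin_ne_zero_of_mem_brillouinZone hkB h0 h1)
  have hne : bandEnergy p hVp.lift n k ≠ bandEnergy p hVp.lift m k := fun h => hnm <| by
    rw [← ncard_levelBelow_bandEnergy F hVp hV n hcos, h,
      ncard_levelBelow_bandEnergy F hVp hV m hcos]
  -- the smaller energy `E` and a point `z` of a gap above it, at distance at most `ε`
  obtain ⟨E, z, hE, hEd, hEz, hzε, hz⟩ : ∃ E z, -R ≤ E ∧ F.disc E = 2 * Real.cos (k * p) ∧
      E ≤ z ∧ z - E ≤ ε ∧ 2 ≤ |F.disc z| := by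
    have key : ∀ i j, bandEnergy p hVp.lift i k < bandEnergy p hVp.lift j k →
        |bandEnergy p hVp.lift j k - bandEnergy p hVp.lift i k| ≤ ε →
        ∃ E z, -R ≤ E ∧ F.disc E = 2 * Real.cos (k * p) ∧ E ≤ z ∧ z - E ≤ ε ∧
          2 ≤ |F.disc z| := by
      intro i j hij hijε
      obtain ⟨z, hz, hz2⟩ := (F.isDiscriminant hp0 hV).exists_two_le_abs hij
        ((disc_bandEnergy F hVp hV i k).trans (disc_bandEnergy F hVp hV j k).symm)
      rw [abs_of_pos (sub_pos.2 hij)] at hijε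
      exact ⟨_, z, neg_le_bandEnergy F hVp hV i k, disc_bandEnergy F hVp hV i k, hz.1.le,
        by linarith [hz.2], hz2⟩
    rcases lt_or_gt_of_ne hne with h | h
    · exact key n m h hle
    · exact key m n h (by rwa [abs_sub_comm])
  have hsq : Real.pi ^ 2 * Real.exp (9 * √R * p) * |z - E| ≤ L ^ 2 := by
    have e1 : L ^ 2 = 5 * Real.pi * Real.exp (10 * √R * p) * ε := by
      rw [hL, mul_pow, mul_pow, Real.sq_sqrt (by positivity), Real.sq_sqrt hε,
        ← Real.exp_nat_mul]
      congr 3; push_cast; ring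
    have e2 : Real.exp (9 * √R * p) ≤ Real.exp (10 * √R * p) := by
      gcongr; norm_num
    have e3 : Real.pi ^ 2 ≤ 5 * Real.pi := by nlinarith [Real.pi_le_four]
    rw [e1, abs_of_nonneg (by linarith)]
    gcongr
  have hkm := abs_mul_mem_Icc hkB
  have hdE : F.disc E = 2 * Real.cos (|k| * p) := by rw [hEd, cos_mul_eq_cos_abs_mul hp0]
  have hc1 := Real.cos_le_one (|k| * p)
  have hc2 := Real.neg_one_le_cos (|k| * p)
  rcases le_abs'.1 hz with h | h
  · right
    have hpp : Real.pi / p * p = Real.pi := by field_simp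
    have hq := F.sq_sub_le_of_disc hV hE (hE.trans hEz) hkm (κ' := Real.pi / p)
      (by rw [hpp]; exact ⟨hpi.le, le_rfl⟩) (by
        rw [hpp, Real.cos_pi, hdE,
          abs_of_nonpos (a := 2 * -1 - 2 * Real.cos (|k| * p)) (by linarith)]
        exact le_trans (by linarith) (neg_le_abs _))
    exact (le_abs_self _).trans (abs_le_of_sq_le_sq (hq.trans hsq) hL0)
  · left
    have hq := F.sq_sub_le_of_disc hV hE (hE.trans hEz) hkm (κ' := 0)
      (by rw [zero_mul]; exact ⟨le_rfl, hpi.le⟩) (by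
        rw [zero_mul, Real.cos_zero, hdE,
          abs_of_nonneg (a := 2 * 1 - 2 * Real.cos (|k| * p)) (by linarith)]
        exact le_trans (by linarith) (le_abs_self _))
    rw [zero_sub, neg_sq] at hq
    exact (le_abs_self _).trans (abs_le_of_sq_le_sq (hq.trans hsq) hL0)

theorem volume_closeBands_le (F : FundamentalSystem p V) (hVp : Function.Periodic V p)
    (hV : BoundedPotential V R) {ε : ℝ} (hε : 0 ≤ ε) :
    volume (closeBands p hVp.lift ε) ≤
      ENNReal.ofReal (4 * √(5 * Real.pi) * Real.exp (5 * √R * p) * √ε) := by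
  set L := √(5 * Real.pi) * Real.exp (5 * √R * p) * √ε with hL
  have hL0 : 0 ≤ L := by positivity
  have hsub : closeBands p hVp.lift ε ⊆ Icc (-L) L ∪
      (Icc (-(Real.pi / p)) (-(Real.pi / p) + L) ∪ Icc (Real.pi / p - L) (Real.pi / p)) := by
    intro k hk
    have hkB := hk.1
    rcases close_of_mem_closeBands F hVp hV hε hk with h | h
    · exact Or.inl (abs_le.1 h)
    · right
      rcases le_total 0 k with h0 | h0
      · rw [abs_of_nonneg h0] at h
        exact Or.inr ⟨by linarith, hkB.2⟩
      · rw [abs_of_nonpos h0] at h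
        exact Or.inl ⟨hkB.1.le, by linarith⟩
  calc volume (closeBands p hVp.lift ε)
      ≤ volume (Icc (-L) L) + (volume (Icc (-(Real.pi / p)) (-(Real.pi / p) + L)) +
          volume (Icc (Real.pi / p - L) (Real.pi / p))) :=
        (measure_mono hsub).trans ((measure_union_le _ _).trans
          (add_le_add le_rfl (measure_union_le _ _)))
    _ = ENNReal.ofReal (4 * √(5 * Real.pi) * Real.exp (5 * √R * p) * √ε) := by
        rw [Real.volume_Icc, Real.volume_Icc, Real.volume_Icc,
          ← ENNReal.ofReal_add (by linarith) (by linarith),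
          ← ENNReal.ofReal_add (by linarith) (by linarith)]
        congr 1
        rw [hL]; ring

end Bands

end FloquetBloch

theorem lemma2p3 :
    ∃ C₂ : ℝ, 0 < C₂ ∧
      ∀ (p : ℝ) [Fact (0 < p)] (R : ℝ) (V : ℝ → ℝ) (hV : Function.Periodic V p),
        AEStronglyMeasurable V volume → (∀ᵐ x : ℝ, |V x| ≤ R) →
        (∀ m : ℕ, ∀ k ∈ FloquetBloch.brillouinZone p,
          (k ≠ 0 → k ≠ Real.pi / p →
            DifferentiableAt ℝ (FloquetBloch.bandEnergy p hV.lift m) k) ∧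
          2 * |Real.sin (p * k)| / (C₂ * p) * Real.exp (-2 * C₂ * Real.sqrt R * p) ≤
            |deriv (FloquetBloch.bandEnergy p hV.lift m) k|) ∧
        (∀ m : ℕ, ∀ k₁ ∈ FloquetBloch.brillouinZone p, ∀ k₂ ∈ FloquetBloch.brillouinZone p,
          Real.exp (-2 * C₂ * Real.sqrt R * p) / (Real.pi * C₂) * (|k₂| - |k₁|) ^ 2 ≤
            |FloquetBloch.bandEnergy p hV.lift m k₂ -
              FloquetBloch.bandEnergy p hV.lift m k₁|) ∧
        (∀ ε : ℝ, 0 ≤ ε →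
          volume (FloquetBloch.closeBands p hV.lift ε) ≤
            ENNReal.ofReal (4 * Real.sqrt (C₂ * Real.pi) *
              Real.exp (C₂ * Real.sqrt R * p) * Real.sqrt ε)) := by
  -- `5` is large enough because the Lipschitz constant of the discriminant has the prefactor `4`
  -- and the exponent `9 √R p ≤ 2 * 5 √R p`, and because `π² ≤ 5 π`
  refine ⟨5, by norm_num, fun p hp R V hVp hm hb => ?_⟩
  have hV : FloquetBloch.BoundedPotential V R := ⟨hm, hb⟩
  obtain ⟨F⟩ := hV.nonempty_fundamentalSystem (p := p) hp.out.le
  refine ⟨fun m k hk => ⟨fun h0 h1 => ?_, ?_⟩, fun m k₁ hk₁ k₂ hk₂ =>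
    FloquetBloch.bandEnergy_sub_lower_bound F hVp hV m hk₁ hk₂, fun ε hε =>
    FloquetBloch.volume_closeBands_le F hVp hV hε⟩
  · exact (FloquetBloch.hasDerivAt_bandEnergy F hVp hV m (FloquetBloch.abs_cos_lt_of_sin_ne_zero
      (FloquetBloch.sin_ne_zero_of_mem_brillouinZone hk h0 h1))).differentiableAt
  · -- at `k = 0` and `k = π/p` the left-hand side vanishes
    by_cases h : Real.sin (k * p) = 0
    · rw [mul_comm p k, h]; simp
    · exact FloquetBloch.deriv_bandEnergy_lower_bound F hVp hV m
        (FloquetBloch.abs_cos_lt_of_sin_ne_zero h)
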